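/- Let $g \ge 1$ and $m \ge 1$ be integers. Let $\Lambda$ be a free abelian group of rank $2g$ with a unimodular alternating $\mathbb{Z}$-bilinear form $J\colon \Lambda\times\Lambda\to\mathbb{Z}$ (that is, $J$ has determinant $1$; equivalently, $x \mapsto J(x,\cdot)$ is an isomorphism $\Lambda\to\mathrm{Hom}(\Lambda,\mathbb{Z})$), and set $V=\Lambda\otimes\mathbb{Q}\cong\mathbb{Q}^{2g}$. Let $\mathrm{Sp}(\Lambda)$ be the group of automorphisms of $\Lambda$ preserving $J$, and let $\mathrm{Sp}(\Lambda)[m]$ be the subgroup of those that act trivially on $\Lambda/m\Lambda$. A $p$-dimensional isotropic subspace of $\Lambda/m\Lambda\cong(\mathbb{Z}/m\mathbb{Z})^{2g}$ means a direct summand that is free of rank $p$ over $\mathbb{Z}/m\mathbb{Z}$ and on which the reduction of $J$ modulo $m$ vanishes. Let $\phi$ be Euler's function, and put $\epsilon_m=1$ if $m\in\{1,2\}$ and $\epsilon_m=\frac12$ if $m\ge 3$. For every $1\le p\le g$, the number $\pi_{g,p,m}$ of $\mathrm{Sp}(\Lambda)[m]$-orbits of $p$-dimensional isotropic subspaces of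 $V$ is finite and $$\pi_{g,p,m}=\epsilon_m\,\phi(m)\cdot\bigl|\{\,p\text{-dimensional isotropic subspaces of }(\mathbb{Z}/m\mathbb{Z})^{2g}\,\}\bigr|.$$ Moreover, the number of $g$-dimensional isotropic subspaces of $(\mathbb{Z}/m\mathbb{Z})^{2g}$ is $$m^{g(g+1)/2}\prod_{\substack{q\text{ prime}\\ q\mid m}}\ \prod_{i=1}^{g}\left(1+\frac1{q^{i}}\right),$$ and consequently $$\pi_{g,g,m}=\epsilon_m\, m^{g(g+1)/2}\,\phi(m)\prod_{\substack{q\text{ prime}\\ q\mid m}}\ \prod_{i=1}^{g}\left(1+\frac1{q^{i}}\right).$$ -/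

import Mathlib

open scoped TensorProduct

namespace SymplecticLattice

variable {Λ : Type*} [AddCommGroup Λ]

/-- The symplectic group `Sp(Λ)` of a lattice `Λ` with bilinear form `J`: the group of
automorphisms of `Λ` that preserve `J`. -/
def sp (J : LinearMap.BilinForm ℤ Λ) : Subgroup (Λ ≃ₗ[ℤ] Λ) where
  carrier := {γ | ∀ x y, J (γ x) (γ y) = J x y}
  mul_mem' := by
    intro a b ha hb x y
    simp only [LinearEquiv.mul_apply]
    rw [ha, hb]
  one_mem' := by
    intro x y
    rfl
  inv_mem' := by
    intro a ha x y
    have h := ha (a⁻¹ x) (a⁻¹ y)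
    rw [← LinearEquiv.mul_apply, ← LinearEquiv.mul_apply, mul_inv_cancel] at h
    exact h.symm

/-- The action of `Sp(Λ)` on `A ⊗ Λ`, as a homomorphism to the endomorphisms of `A ⊗ Λ`. -/
noncomputable def spBaseChange (A : Type*) [CommRing A] (J : LinearMap.BilinForm ℤ Λ) :
    sp J →* Module.End A (A ⊗[ℤ] Λ) where
  toFun γ := ((γ : Λ ≃ₗ[ℤ] Λ) : Λ →ₗ[ℤ] Λ).baseChange A
  map_one' := LinearMap.baseChange_id
  map_mul' _ b := LinearMap.baseChange_comp ((b : Λ ≃ₗ[ℤ] Λ) : Λ →ₗ[ℤ] Λ) _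

/-- The level `m` subgroup `Sp(Λ)[m]`: the elements of `Sp(Λ)` that act trivially on
`ℤ/m ⊗ Λ = Λ/mΛ`. -/
noncomputable def spLevel (J : LinearMap.BilinForm ℤ Λ) (m : ℕ) : Subgroup (sp J) :=
  (spBaseChange (ZMod m) J).ker

/-- A submodule `W` of `A ⊗ Λ` is isotropic if the `A`-bilinear extension of `J` vanishes on it. -/
def IsIsotropic {A : Type*} [CommRing A] (J : LinearMap.BilinForm ℤ Λ)
    (W : Submodule A (A ⊗[ℤ] Λ)) : Prop :=
  ∀ v ∈ W, ∀ w ∈ W, J.baseChange A v w = 0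

/-- The `p`-dimensional isotropic subspaces of the rational vector space `ℚ ⊗ Λ`. -/
def RatIsotropic (J : LinearMap.BilinForm ℤ Λ) (p : ℕ) : Type _ :=
  {W : Submodule ℚ (ℚ ⊗[ℤ] Λ) // IsIsotropic J W ∧ Module.finrank ℚ W = p}

/-- The `p`-dimensional isotropic subspaces of `(ℤ/m) ⊗ Λ = Λ/mΛ ≅ (ℤ/m)^{2g}`: the isotropic
direct summands that are free of rank `p` over `ℤ/m`. -/
def ModIsotropic (J : LinearMap.BilinForm ℤ Λ) (m p : ℕ) : Type _ :=
  {W : Submodule (ZMod m) (ZMod m ⊗[ℤ] Λ) //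
    IsIsotropic J W ∧ Nonempty (Module.Basis (Fin p) (ZMod m) W) ∧ ∃ W', IsCompl W W'}

theorem spBaseChange_tmul {A : Type*} [CommRing A] (J : LinearMap.BilinForm ℤ Λ) (γ : sp J)
    (a : A) (x : Λ) :
    spBaseChange A J γ (a ⊗ₜ[ℤ] x) = a ⊗ₜ[ℤ] ((γ : Λ ≃ₗ[ℤ] Λ) x) := rfl

theorem baseChange_spBaseChange {A : Type*} [CommRing A] (J : LinearMap.BilinForm ℤ Λ) (γ : sp J)
    (v w : A ⊗[ℤ] Λ) :
    J.baseChange A (spBaseChange A J γ v) (spBaseChange A J γ w) = J.baseChange A v w := by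
  induction v using TensorProduct.induction_on with
  | zero => simp
  | add v₁ v₂ h₁ h₂ => simp only [map_add, LinearMap.add_apply, h₁, h₂]
  | tmul a x =>
    induction w using TensorProduct.induction_on with
    | zero => simp
    | add w₁ w₂ h₁ h₂ => simp only [map_add, h₁, h₂]
    | tmul b y =>
      have h : J ((γ : Λ ≃ₗ[ℤ] Λ) x) ((γ : Λ ≃ₗ[ℤ] Λ) y) = J x y := γ.2 x y
      simp [spBaseChange_tmul, h]

theorem spBaseChange_injective {A : Type*} [CommRing A] (J : LinearMap.BilinForm ℤ Λ) (γ : sp J) :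
    Function.Injective (spBaseChange A J γ) := by
  refine Function.LeftInverse.injective (g := spBaseChange A J γ⁻¹) fun v => ?_
  rw [← Module.End.mul_apply, ← map_mul, inv_mul_cancel, map_one, Module.End.one_apply]

/-- `Sp(Λ)` acts on the `p`-dimensional isotropic subspaces of `ℚ ⊗ Λ` by taking images. -/
noncomputable instance (J : LinearMap.BilinForm ℤ Λ) (p : ℕ) :
    MulAction (sp J) (RatIsotropic J p) where
  smul γ W := ⟨W.1.map (spBaseChange ℚ J γ), by
    refine ⟨?_, ?_⟩
    · rintro _ ⟨v, hv, rfl⟩ _ ⟨w, hw, rfl⟩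
      rw [baseChange_spBaseChange]
      exact W.2.1 v hv w hw
    · rw [← (Submodule.equivMapOfInjective _ (spBaseChange_injective J γ) W.1).finrank_eq]
      exact W.2.2⟩
  one_smul W := by
    apply Subtype.ext
    change W.1.map (spBaseChange ℚ J 1) = W.1
    rw [map_one]
    exact Submodule.map_id _
  mul_smul a b W := by
    apply Subtype.ext
    change W.1.map (spBaseChange ℚ J (a * b)) =
      (W.1.map (spBaseChange ℚ J b)).map (spBaseChange ℚ J a)
    rw [map_mul]
    exact Submodule.map_comp _ _ _

/-- The number of `Sp(Λ)[m]`-orbits of `p`-dimensional isotropic subspaces of `ℚ ⊗ Λ`. -/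
noncomputable def orbitCount (J : LinearMap.BilinForm ℤ Λ) (m p : ℕ) : ℕ :=
  Nat.card (MulAction.orbitRel.Quotient (spLevel J m) (RatIsotropic J p))

/-- The factor `1/2`, which is omitted for `m = 1, 2`. -/
def epsilon (m : ℕ) : ℚ := if m = 1 ∨ m = 2 then 1 else 1 / 2

end SymplecticLattice

/-! Call a tuple of pairwise orthogonal vectors a frame if its pairings with the whole module take
arbitrary values. By unimodularity, frames are exactly the bases of isotropic direct summands, over
ℤ as well as modulo m. The first formula is a double count of the frames of length p modulo m.

On one side, an isotropic summand modulo m determines its frame up to a free action of GL_p(ℤ/m)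
(`card_frame_eq_card_modIsotropic`). On the other side, a rational isotropic subspace W gives the
isotropic summand W ∩ Λ, whose bases are frames and form one GL_p(ℤ)-orbit (`ratSpan_surjective`,
`ratSpan_eq_iff`). Every frame modulo m lifts to Λ (`IsReduction.exists_lift_frame`), and Sp(Λ)[m]
permutes its lifts transitively (`IsReduction.exists_isometry`). So the orbits of subspaces are the
frames modulo m up to the image of GL_p(ℤ), which consists of the matrices of determinant ±1
(`exists_GL_int_lift`). The two counts therefore differ by the index of {±1} in the units of ℤ/m,
which is ε_m φ(m).

For p = g, splitting off a hyperbolic pair gives a recursion for the number of frames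
(`IsReduction.card_frame_succ`), parallel to the recursion for |GL_g(ℤ/m)| by first columns
(`card_GL_succ`). The quotient of their n-th steps is the number of unimodular vectors of length 2n
over that of length n, namely m^n ∏ (1 + q^{-n}); the product over n ≤ g is the second formula. -/

namespace SymplecticLattice

/-! ### Frames and their change by invertible matrices -/

section Frames

variable {R M : Type*} [CommRing R] [AddCommGroup M] [Module R M]

/-- A frame of length `p` for a bilinear form `B`: pairwise orthogonal vectors whose pairings with
the module take all values independently. -/
structure IsFrame (B : LinearMap.BilinForm R M) {p : ℕ} (v : Fin p → M) : Prop where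
  isotropic : ∀ i j, B (v i) (v j) = 0
  split : ∀ c : Fin p → R, ∃ y, ∀ i, B (v i) y = c i

/-- The tuple obtained from `v` by the linear substitution with matrix `A`. -/
def comb {p : ℕ} (A : Matrix (Fin p) (Fin p) R) (v : Fin p → M) : Fin p → M :=
  fun i => ∑ j, A i j • v j

variable {p : ℕ} {B : LinearMap.BilinForm R M} {v w : Fin p → M}

theorem comb_one (v : Fin p → M) : comb (1 : Matrix (Fin p) (Fin p) R) v = v := by
  ext i
  simp [comb, Matrix.one_apply]

theorem comb_mul (A A' : Matrix (Fin p) (Fin p) R) (v : Fin p → M) :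
    comb (A * A') v = comb A (comb A' v) := by
  ext i
  simp only [comb, Matrix.mul_apply, Finset.sum_smul, Finset.smul_sum, mul_smul]
  exact Finset.sum_comm

theorem comb_mem_span (A : Matrix (Fin p) (Fin p) R) (v : Fin p → M) (i : Fin p) :
    comb A v i ∈ Submodule.span R (Set.range v) :=
  Submodule.sum_mem _ fun j _ => Submodule.smul_mem _ _ (Submodule.subset_span ⟨j, rfl⟩)

theorem IsFrame.linearIndependent (h : IsFrame B v) : LinearIndependent R v := by
  rw [Fintype.linearIndependent_iff]
  intro c hc i
  obtain ⟨y, hy⟩ := h.split (Pi.single i 1)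
  have := congrArg (fun x => B x y) hc
  simpa [map_sum, LinearMap.sum_apply, hy, Pi.single_apply] using this

theorem IsFrame.comb (h : IsFrame B v) (A : GL (Fin p) R) : IsFrame B (comb A.1 v) := by
  refine ⟨fun i j => ?_, fun c => ?_⟩
  · simp [SymplecticLattice.comb, LinearMap.sum_apply, h.isotropic]
  · obtain ⟨y, hy⟩ := h.split ((A⁻¹).1.mulVec c)
    refine ⟨y, fun i => ?_⟩
    have : A.1.mulVec ((A⁻¹).1.mulVec c) i = c i := by
      rw [Matrix.mulVec_mulVec, ← Units.val_mul, mul_inv_cancel, Units.val_one, Matrix.one_mulVec]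
    rw [← this]
    simp [SymplecticLattice.comb, LinearMap.sum_apply, hy, Matrix.mulVec, dotProduct]

theorem IsFrame.comb_injective (h : IsFrame B v) {A A' : Matrix (Fin p) (Fin p) R}
    (hA : SymplecticLattice.comb A v = SymplecticLattice.comb A' v) : A = A' := by
  ext i j
  obtain ⟨y, hy⟩ := h.split (Pi.single j 1)
  have := congrArg (fun x => B (x i) y) hA
  simpa [SymplecticLattice.comb, map_sum, LinearMap.sum_apply, hy, Pi.single_apply] using this

theorem exists_comb_of_mem_span (h : ∀ i, w i ∈ Submodule.span R (Set.range v)) :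
    ∃ A : Matrix (Fin p) (Fin p) R, SymplecticLattice.comb A v = w := by
  have := fun i => (Submodule.mem_span_range_iff_exists_fun R).1 (h i)
  choose A hA using this
  exact ⟨A, funext hA⟩

/-- Coefficients with respect to a frame are unique, so the two transition matrices are inverse to
each other. -/
theorem IsFrame.exists_comb_of_mem_span (hv : IsFrame B v) (hw : IsFrame B w)
    (h₁ : ∀ i, w i ∈ Submodule.span R (Set.range v))
    (h₂ : ∀ i, v i ∈ Submodule.span R (Set.range w)) :
    ∃ A : GL (Fin p) R, SymplecticLattice.comb A.1 v = w := by
  obtain ⟨A, hA⟩ := SymplecticLattice.exists_comb_of_mem_span h₁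
  obtain ⟨A', hA'⟩ := SymplecticLattice.exists_comb_of_mem_span h₂
  refine ⟨⟨A, A', hw.comb_injective ?_, hv.comb_injective ?_⟩, hA⟩
  · rw [comb_mul, hA', hA, comb_one]
  · rw [comb_mul, hA, hA', comb_one]

theorem span_comb (A : GL (Fin p) R) (v : Fin p → M) :
    Submodule.span R (Set.range (comb A.1 v)) = Submodule.span R (Set.range v) := by
  apply le_antisymm
  · rw [Submodule.span_le]
    rintro _ ⟨i, rfl⟩
    exact comb_mem_span _ _ _
  · rw [Submodule.span_le]
    rintro _ ⟨i, rfl⟩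
    have h : comb (A⁻¹).1 (comb A.1 v) = v := by
      rw [← comb_mul, ← Units.val_mul, inv_mul_cancel, Units.val_one, comb_one]
    have := comb_mem_span (A⁻¹).1 (comb A.1 v) i
    rwa [h] at this

theorem IsFrame.span_eq_span_iff (hv : IsFrame B v) (hw : IsFrame B w) :
    Submodule.span R (Set.range v) = Submodule.span R (Set.range w) ↔
      ∃ A : GL (Fin p) R, w = SymplecticLattice.comb A.1 v := by
  constructor
  · intro h
    obtain ⟨A, hA⟩ := hv.exists_comb_of_mem_span hw
      (fun i => h ▸ Submodule.subset_span ⟨i, rfl⟩) (fun i => h ▸ Submodule.subset_span ⟨i, rfl⟩)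
    exact ⟨A, hA.symm⟩
  · rintro ⟨A, rfl⟩
    exact (span_comb A v).symm

end Frames

/-! ### Splitting off a hyperbolic pair -/

section HyperbolicComplement

variable {R M : Type*} [CommRing R] [AddCommGroup M] [Module R M]

/-- The orthogonal complement of the pair `e`, `f`. -/
def hypCompl (B : LinearMap.BilinForm R M) (e f : M) : Submodule R M :=
  LinearMap.ker (B e) ⊓ LinearMap.ker (B f)

/-- The restriction of `B` to the orthogonal complement of `e`, `f`. -/
abbrev hypForm (B : LinearMap.BilinForm R M) (e f : M) :
    LinearMap.BilinForm R (hypCompl B e f) :=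
  B.restrict (hypCompl B e f)

variable {B : LinearMap.BilinForm R M} {e f : M}

theorem mem_hypCompl {x : M} : x ∈ hypCompl B e f ↔ B e x = 0 ∧ B f x = 0 := Iff.rfl

theorem hypForm_apply (x y : hypCompl B e f) : hypForm B e f x y = B x y := rfl

theorem hypForm_isAlt (hB : B.IsAlt) : (hypForm B e f).IsAlt := fun x => hB x

theorem swap_pair (hB : B.IsAlt) (hef : B e f = 1) : B f e = -1 := by
  rw [← hef, hB.neg_eq]

/-- The orthogonal projection to the complement of a hyperbolic pair. -/
def hypProj (hB : B.IsAlt) (hef : B e f = 1) : M →ₗ[R] hypCompl B e f :=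
  LinearMap.codRestrict (hypCompl B e f)
    (LinearMap.id + (B f).smulRight e - (B e).smulRight f) fun x => by
      simp [mem_hypCompl, hB.self_eq_zero, hef, swap_pair hB hef]

theorem hypProj_apply (hB : B.IsAlt) (hef : B e f = 1) (x : M) :
    (hypProj hB hef x : M) = x + B f x • e - B e x • f := rfl

theorem hypProj_coe (hB : B.IsAlt) (hef : B e f = 1) (x : hypCompl B e f) :
    hypProj hB hef x = x := by
  apply Subtype.ext
  simp [hypProj_apply, (mem_hypCompl.1 x.2).1, (mem_hypCompl.1 x.2).2]

/-- The projection changes `x` only by multiples of `e` and `f`, to which `k` is orthogonal. -/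
theorem pair_coe_hypProj (hB : B.IsAlt) (hef : B e f = 1) (k : hypCompl B e f) (x : M) :
    B k (hypProj hB hef x) = B k x := by
  have h1 := (mem_hypCompl.1 k.2).1
  have h2 := (mem_hypCompl.1 k.2).2
  rw [← hB.neg_eq, neg_eq_zero] at h1 h2
  simp [hypProj_apply, h1, h2]

/-- The splitting of a module along a hyperbolic pair. -/
def hypEquiv (hB : B.IsAlt) (hef : B e f = 1) : M ≃ₗ[R] (R × R) × hypCompl B e f :=
  LinearEquiv.ofLinearMap
    (LinearMap.prod (LinearMap.prod (-(B f)) (B e)) (hypProj hB hef))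
    (LinearMap.coprod (LinearMap.coprod (LinearMap.toSpanSingleton R M e)
      (LinearMap.toSpanSingleton R M f)) (hypCompl B e f).subtype)
    (by
      apply LinearMap.ext
      rintro ⟨⟨a, b⟩, k⟩
      have h1 := (mem_hypCompl.1 k.2).1
      have h2 := (mem_hypCompl.1 k.2).2
      have he : hypProj hB hef e = 0 := by
        apply Subtype.ext; simp [hypProj_apply, hB.self_eq_zero, swap_pair hB hef]
      have hf : hypProj hB hef f = 0 := by
        apply Subtype.ext; simp [hypProj_apply, hB.self_eq_zero, hef]
      simp [hB.self_eq_zero, hef, swap_pair hB hef, h1, h2, he, hf, hypProj_coe])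
    (by
      apply LinearMap.ext
      intro x
      simp [hypProj_apply])

theorem hypEquiv_symm_apply (hB : B.IsAlt) (hef : B e f = 1) (a b : R) (k : hypCompl B e f) :
    (hypEquiv hB hef).symm ((a, b), k) = a • e + b • f + k := rfl

theorem pair_hypEquiv_symm (hB : B.IsAlt) (hef : B e f = 1) (s t : (R × R) × hypCompl B e f) :
    B ((hypEquiv hB hef).symm s) ((hypEquiv hB hef).symm t) =
      s.1.1 * t.1.2 - s.1.2 * t.1.1 + hypForm B e f s.2 t.2 := by
  obtain ⟨⟨a, b⟩, k⟩ := s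
  obtain ⟨⟨a', b'⟩, k'⟩ := t
  have h1 := (mem_hypCompl.1 k.2).1
  have h2 := (mem_hypCompl.1 k.2).2
  rw [← hB.neg_eq, neg_eq_zero] at h1 h2
  have h1' := (mem_hypCompl.1 k'.2).1
  have h2' := (mem_hypCompl.1 k'.2).2
  simp only [hypEquiv_symm_apply, map_add, map_smul, LinearMap.add_apply, LinearMap.smul_apply,
    hB.self_eq_zero, hef, swap_pair hB hef, h1, h2, h1', h2', smul_eq_mul, hypForm_apply]
  ring

/-- This lets inductions on the rank pass to the complement: a functional there extends by
`hypProj`, and the vector representing it is projected back. -/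
theorem hypForm_bijective (hB : B.IsAlt) (hef : B e f = 1) (h : Function.Bijective B) :
    Function.Bijective (hypForm B e f) := by
  constructor
  · rw [injective_iff_map_eq_zero]
    intro k hk
    apply Subtype.ext
    refine (injective_iff_map_eq_zero B).1 h.1 _ (LinearMap.ext fun x => ?_)
    rw [← pair_coe_hypProj hB hef]
    exact LinearMap.congr_fun hk (hypProj hB hef x)
  · intro l
    obtain ⟨z, hz⟩ := h.2 (l ∘ₗ hypProj hB hef)
    refine ⟨hypProj hB hef z, LinearMap.ext fun k => ?_⟩
    have := LinearMap.congr_fun hz k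
    rw [LinearMap.comp_apply, hypProj_coe] at this
    rw [← this, hypForm_apply, ← hB.neg_eq, pair_coe_hypProj, hB.neg_eq]

variable {p : ℕ}

/-- A frame of the complement of a hyperbolic pair `e`, `f` becomes a frame after adding `e`, and
any vector of the frame may be changed by a multiple of `e`. -/
theorem IsFrame.cons_add (hB : B.IsAlt) (hef : B e f = 1) {k : Fin p → hypCompl B e f}
    (hk : IsFrame (hypForm B e f) k) (a : Fin p → R) :
    IsFrame B (Fin.cons e (fun i => a i • e + (k i : M))) := by
  have h1 : ∀ i, B e (k i) = 0 := fun i => (mem_hypCompl.1 (k i).2).1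
  have h2 : ∀ i, B (k i) e = 0 := fun i => by rw [← hB.neg_eq, h1, neg_zero]
  have h3 : ∀ i, B (k i) f = 0 := fun i => by
    rw [← hB.neg_eq, (mem_hypCompl.1 (k i).2).2, neg_zero]
  have h4 : ∀ i j, B (k i) (k j) = 0 := fun i j => hk.isotropic i j
  refine ⟨fun i j => ?_, fun c => ?_⟩
  · refine Fin.cases ?_ (fun i => ?_) i <;> refine Fin.cases ?_ (fun j => ?_) j <;>
      simp [hB.self_eq_zero, h1, h2, h4]
  · obtain ⟨y, hy⟩ := hk.split fun i => c i.succ - a i * c 0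
    have hy' : ∀ i, B (k i) y = c i.succ - a i * c 0 := hy
    refine ⟨c 0 • f + y, fun i => ?_⟩
    refine Fin.cases ?_ (fun i => ?_) i
    · simp [hef, (mem_hypCompl.1 y.2).1]
    · simp [hef, (mem_hypCompl.1 y.2).1, h3, hy']

theorem IsFrame.cons (hB : B.IsAlt) (hef : B e f = 1) {k : Fin p → hypCompl B e f}
    (hk : IsFrame (hypForm B e f) k) : IsFrame B (Fin.cons e (fun i => (k i : M))) := by
  simpa using hk.cons_add hB hef 0

/-- The vectors of a frame other than the first one, projected to the complement of a hyperbolic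
pair that contains the first one, form a frame there. -/
theorem IsFrame.tail (hB : B.IsAlt) {v : Fin (p + 1) → M} (hv : IsFrame B v)
    (hef : B (v 0) f = 1) : IsFrame (hypForm B (v 0) f) fun i => hypProj hB hef (v i.succ) := by
  have h : ∀ i : Fin p, (hypProj hB hef (v i.succ) : M) = v i.succ + B f (v i.succ) • v 0 :=
    fun i => by simp [hypProj_apply, hv.isotropic]
  refine ⟨fun i j => ?_, fun c => ?_⟩
  · simp [h, hv.isotropic]
  · obtain ⟨y, hy⟩ := hv.split (Fin.cons 0 c)
    refine ⟨hypProj hB hef y, fun i => ?_⟩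
    rw [hypForm_apply, pair_coe_hypProj, h]
    simp [hy]

end HyperbolicComplement

/-! ### Reduction of a lattice modulo m -/

section Reduction

universe u
variable {Λ : Type u} [AddCommGroup Λ] {m : ℕ} {M : Type*} [AddCommGroup M] [Module (ZMod m) M]

/-- The map `ρ` exhibits the module `M` with its form `B` as the reduction modulo `m` of the lattice
`Λ` with its form `J`. -/
structure IsReduction (J : LinearMap.BilinForm ℤ Λ) (B : LinearMap.BilinForm (ZMod m) M)
    (ρ : Λ →+ M) : Prop where
  surjective : Function.Surjective ρ
  exists_of_eq_zero : ∀ x, ρ x = 0 → ∃ y, x = (m : ℤ) • y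
  map_form : ∀ x y, B (ρ x) (ρ y) = (J x y : ZMod m)

variable {J : LinearMap.BilinForm ℤ Λ} {B : LinearMap.BilinForm (ZMod m) M} {ρ : Λ →+ M}

theorem pair_zsmul_left (J : LinearMap.BilinForm ℤ Λ) (a : ℤ) (x y : Λ) :
    J (a • x) y = a * J x y := by
  rw [map_zsmul]
  rfl

theorem pair_zsmul_right (J : LinearMap.BilinForm ℤ Λ) (a : ℤ) (x y : Λ) :
    J x (a • y) = a * J x y := by
  rw [map_zsmul, smul_eq_mul]

theorem IsReduction.map_smul (_ : IsReduction J B ρ) (a : ℤ) (x : Λ) :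
    ρ (a • x) = (a : ZMod m) • ρ x := by
  rw [map_zsmul, Int.cast_smul_eq_zsmul]

theorem IsReduction.map_level (h : IsReduction J B ρ) (x : Λ) : ρ ((m : ℤ) • x) = 0 := by
  rw [h.map_smul]
  simp

theorem IsReduction.isAlt (h : IsReduction J B ρ) (hJ : J.IsAlt) : B.IsAlt := by
  intro x
  obtain ⟨x, rfl⟩ := h.surjective x
  rw [h.map_form, hJ.self_eq_zero, Int.cast_zero]

theorem IsReduction.isFrame (h : IsReduction J B ρ) {p : ℕ} {v : Fin p → Λ} (hv : IsFrame J v) :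
    IsFrame B (fun i => ρ (v i)) := by
  refine ⟨fun i j => by rw [h.map_form, hv.isotropic, Int.cast_zero], fun c => ?_⟩
  choose c' hc' using fun i => ZMod.intCast_surjective (c i)
  obtain ⟨y, hy⟩ := hv.split c'
  exact ⟨ρ y, fun i => by rw [h.map_form, hy, hc']⟩

/-- Pairings with a frame that have the right values modulo `m` can be corrected. -/
theorem IsReduction.exists_lift_pairing (h : IsReduction J B ρ) {p : ℕ} {v : Fin p → Λ}
    (hv : IsFrame J v) (y : M) (c : Fin p → ℤ) (hy : ∀ i, B (ρ (v i)) y = c i) :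
    ∃ z, ρ z = y ∧ ∀ i, J (v i) z = c i := by
  obtain ⟨x, rfl⟩ := h.surjective y
  have : ∀ i, ∃ d, J (v i) x - c i = m * d := fun i => by
    have := hy i
    rw [h.map_form, ← sub_eq_zero, ← Int.cast_sub, ZMod.intCast_zmod_eq_zero_iff_dvd] at this
    exact this
  choose d hd using this
  -- The errors in the pairings are the multiples `m * d i`; subtracting `m • u` removes them
  -- without changing the reduction.
  obtain ⟨u, hu⟩ := hv.split d
  refine ⟨x - (m : ℤ) • u, by rw [map_sub, h.map_level, sub_zero], fun i => ?_⟩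
  have := hd i
  rw [map_sub, pair_zsmul_right, hu]
  linarith

theorem isFrame_one {R N : Type*} [CommRing R] [AddCommGroup N] [Module R N]
    {C : LinearMap.BilinForm R N} (hC : C.IsAlt) {v : Fin 1 → N} {y : N} (hy : C (v 0) y = 1) :
    IsFrame C v := by
  refine ⟨fun i j => ?_, fun c => ⟨c 0 • y, fun i => ?_⟩⟩
  · rw [Subsingleton.elim i j, hC.self_eq_zero]
  · rw [Subsingleton.elim i 0, map_smul, hy, smul_eq_mul, mul_one]

/-- The reduction map on the complement of a hyperbolic pair. -/
def IsReduction.restrict (h : IsReduction J B ρ) {e f : Λ} {e₁ f₁ : M} (he : ρ e = e₁)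
    (hf : ρ f = f₁) : hypCompl J e f →+ hypCompl B e₁ f₁ where
  toFun k := ⟨ρ k, by
    simp [mem_hypCompl, ← he, ← hf, h.map_form, (mem_hypCompl.1 k.2).1, (mem_hypCompl.1 k.2).2]⟩
  map_zero' := by simp
  map_add' := by simp

theorem IsReduction.coe_restrict (h : IsReduction J B ρ) {e f : Λ} {e₁ f₁ : M} (he : ρ e = e₁)
    (hf : ρ f = f₁) (k : hypCompl J e f) : (h.restrict he hf k : M) = ρ k := rfl

theorem IsReduction.coe_hypProj (h : IsReduction J B ρ) (hJ : J.IsAlt) {e f : Λ}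
    (hef : J e f = 1) (hef' : B (ρ e) (ρ f) = 1) (x : Λ) :
    ρ (hypProj hJ hef x) = hypProj (h.isAlt hJ) hef' (ρ x) := by
  simp only [hypProj_apply, map_add, map_sub, h.map_smul, h.map_form]

theorem IsReduction.map_pair (h : IsReduction J B ρ) {e f : Λ} (hef : J e f = 1) :
    B (ρ e) (ρ f) = 1 := by
  rw [h.map_form, hef, Int.cast_one]

/-- Orthogonal projection commutes with `ρ`, so preimages and quotients by `m` found in the whole
lattice can be projected to the complement. -/
theorem IsReduction.isReduction_restrict (h : IsReduction J B ρ) (hJ : J.IsAlt) {e f : Λ}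
    (hef : J e f = 1) {e₁ f₁ : M} (he : ρ e = e₁) (hf : ρ f = f₁) :
    IsReduction (hypForm J e f) (hypForm B e₁ f₁) (h.restrict he hf) := by
  subst he hf
  refine ⟨fun k => ?_, fun k hk => ?_, fun k l => h.map_form k l⟩
  · obtain ⟨x, hx⟩ := h.surjective k
    refine ⟨hypProj hJ hef x, Subtype.ext ?_⟩
    rw [h.coe_restrict, h.coe_hypProj hJ hef (h.map_pair hef), hx, hypProj_coe]
  · obtain ⟨y, hy⟩ := h.exists_of_eq_zero k (congrArg Subtype.val hk)
    refine ⟨hypProj hJ hef y, ?_⟩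
    rw [← map_zsmul, ← hy, hypProj_coe]

end Reduction

/-! ### Lifting frames from ℤ/m to the lattice -/

section Lifting

universe u
variable {Λ : Type u} [AddCommGroup Λ] {J : LinearMap.BilinForm ℤ Λ}

theorem finrank_hypCompl [Module.Free ℤ Λ] [Module.Finite ℤ Λ] (hJ : J.IsAlt) {e f : Λ}
    (hef : J e f = 1) : Module.finrank ℤ Λ = Module.finrank ℤ (hypCompl J e f) + 2 := by
  rw [(hypEquiv hJ hef).finrank_eq, Module.finrank_prod, Module.finrank_prod,
    Module.finrank_self]
  ring

theorem exists_pair [Module.Free ℤ Λ] [Module.Finite ℤ Λ] (hu : Function.Bijective J)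
    (hn : 0 < Module.finrank ℤ Λ) : ∃ e f, J e f = 1 := by
  have b := Module.finBasis ℤ Λ
  obtain ⟨e, he⟩ := hu.2 (b.coord ⟨0, hn⟩)
  exact ⟨e, b ⟨0, hn⟩, by rw [he]; simp⟩

/-- Every element of a unimodular lattice is a multiple of a primitive one. -/
theorem exists_eq_smul_primitive [Module.Free ℤ Λ] [Module.Finite ℤ Λ] (hu : Function.Bijective J)
    {x : Λ} (hx : x ≠ 0) : ∃ (d : ℤ) (e f : Λ), x = d • e ∧ J e f = 1 := by
  -- `d` generates the ideal of values of `J x`. Dividing by `d` gives an integral functional,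
  -- represented by some `e`; as `d` is itself a value `J x f`, the pairing of `e` with `f` is 1.
  obtain ⟨d, hd⟩ : (LinearMap.range (J x)).IsPrincipal := inferInstance
  have hmem : ∀ y, ∃ a, a * d = J x y := fun y => by
    have : J x y ∈ LinearMap.range (J x) := ⟨y, rfl⟩
    rw [hd] at this
    exact Submodule.mem_span_singleton.1 this
  have hd0 : d ≠ 0 := by
    rintro rfl
    refine hx ((injective_iff_map_eq_zero J).1 hu.1 x (LinearMap.ext fun y => ?_))
    obtain ⟨a, ha⟩ := hmem y
    rw [← ha, mul_zero, LinearMap.zero_apply]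
  choose l hl using hmem
  let L : Λ →ₗ[ℤ] ℤ :=
    { toFun := l
      map_add' := fun y z => mul_right_cancel₀ hd0 (by rw [add_mul, hl, hl, hl, map_add])
      map_smul' := fun a y => mul_right_cancel₀ hd0 (by
        rw [RingHom.id_apply, smul_eq_mul, mul_assoc, hl, hl, map_smul, smul_eq_mul]) }
  obtain ⟨e, he⟩ := hu.2 L
  obtain ⟨f, hf⟩ : d ∈ LinearMap.range (J x) := by
    rw [hd]; exact Submodule.mem_span_singleton_self d
  refine ⟨d, e, f, hu.1 (LinearMap.ext fun y => ?_), ?_⟩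
  · rw [pair_zsmul_left, he, mul_comm, ← hl]
    rfl
  · rw [he]
    refine mul_right_cancel₀ hd0 ?_
    rw [one_mul]
    exact (hl f).trans hf

variable {m : ℕ} {M : Type*} [AddCommGroup M] [Module (ZMod m) M]
  {B : LinearMap.BilinForm (ZMod m) M} {ρ : Λ →+ M}

/-- A vector which is unimodular modulo `m` lifts to a primitive vector. -/
theorem IsReduction.exists_lift_primitive [Module.Free ℤ Λ] [Module.Finite ℤ Λ]
    (h : IsReduction J B ρ) (hu : Function.Bijective J) (hJ : J.IsAlt)
    (hn : 0 < Module.finrank ℤ Λ) {x y : M} (hxy : B x y = 1) :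
    ∃ e f, ρ e = x ∧ J e f = 1 := by
  obtain ⟨x, rfl⟩ := h.surjective x
  obtain ⟨y, rfl⟩ := h.surjective y
  -- If `x = 0`, then `1 = 0` in `ZMod m`, so `M` is trivial and any primitive vector will do.
  by_cases hx : x = 0
  · obtain ⟨e, f, hef⟩ := exists_pair hu hn
    refine ⟨e, f, ?_, hef⟩
    have h1 : (1 : ZMod m) = 0 := by rw [← hxy, hx, map_zero, map_zero, LinearMap.zero_apply]
    rw [← one_smul (ZMod m) (ρ e), ← one_smul (ZMod m) (ρ x), h1, zero_smul, zero_smul]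
  · obtain ⟨d, e, f, rfl, hef⟩ := exists_eq_smul_primitive hu hx
    have hdm : IsCoprime d (m : ℤ) := by
      have : ((d * J e y - 1 : ℤ) : ZMod m) = 0 := by
        rw [h.map_form, pair_zsmul_left] at hxy
        rw [Int.cast_sub, hxy, Int.cast_one, sub_self]
      rw [ZMod.intCast_zmod_eq_zero_iff_dvd] at this
      obtain ⟨c, hc⟩ := this
      exact ⟨J e y, -c, by linarith⟩
    obtain ⟨a, b, hab⟩ := hdm
    -- `d • e` need not be primitive. Adding `m • f` keeps its reduction, and pairing with `a • f -
    -- b • e` gives `a * d + b * m = 1`.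
    refine ⟨d • e + (m : ℤ) • f, a • f - b • e, by rw [map_add, h.map_level, add_zero], ?_⟩
    simp only [map_add, map_sub, LinearMap.add_apply, pair_zsmul_left, pair_zsmul_right, hef,
      hJ.self_eq_zero, swap_pair hJ hef]
    linarith

/-- Isotropic frames modulo `m` lift to isotropic frames of the lattice. -/
theorem IsReduction.exists_lift_frame (p : ℕ) : ∀ {Λ : Type u} [AddCommGroup Λ] [Module.Free ℤ Λ]
    [Module.Finite ℤ Λ] {M : Type*} [AddCommGroup M] [Module (ZMod m) M]
    {J : LinearMap.BilinForm ℤ Λ} {B : LinearMap.BilinForm (ZMod m) M} {ρ : Λ →+ M},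
    IsReduction J B ρ → Function.Bijective J → J.IsAlt → 2 * p ≤ Module.finrank ℤ Λ →
    ∀ {v : Fin p → M}, IsFrame B v → ∃ w, IsFrame J w ∧ ∀ i, ρ (w i) = v i := by
  induction p with
  | zero =>
    intro Λ _ _ _ M _ _ J B ρ h hu hJ hn v hv
    exact ⟨Fin.elim0, ⟨fun i => i.elim0, fun c => ⟨0, fun i => i.elim0⟩⟩, fun i => i.elim0⟩
  | succ p ih =>
    intro Λ _ _ _ M _ _ J B ρ h hu hJ hn v hv
    obtain ⟨y, hy⟩ := hv.split (Pi.single 0 1)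
    have hy0 : B (v 0) y = 1 := by simp [hy]
    obtain ⟨e, f', he, hef'⟩ := h.exists_lift_primitive hu hJ (by omega) hy0
    obtain ⟨f, rfl, hf⟩ := h.exists_lift_pairing (v := fun _ : Fin 1 => e) (isFrame_one hJ hef') y
      (fun _ => 1) (fun i => by rw [he, hy0, Int.cast_one])
    have hef := hf 0
    have hrank := finrank_hypCompl hJ hef
    have hB := h.isAlt hJ
    -- The dual vector `y` was chosen orthogonal to the later vectors, so these already lie in the
    -- complement of the pair modulo m.
    have hv' : ∀ i : Fin p, v i.succ ∈ hypCompl B (ρ e) (ρ f) := fun i => by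
      rw [mem_hypCompl, he, hv.isotropic, ← hB.neg_eq, hy]
      simp
    rw [← he] at hy0
    obtain ⟨w, hw, hwv⟩ := ih (h.isReduction_restrict hJ hef rfl rfl) (hypForm_bijective hJ hef hu)
      (hypForm_isAlt hJ) (by omega) (v := fun i => ⟨v i.succ, hv' i⟩) (by
        refine ⟨fun i j => hv.isotropic _ _, fun c => ?_⟩
        obtain ⟨z, hz⟩ := hv.split (Fin.cons 0 c)
        refine ⟨hypProj hB hy0 z, fun i => ?_⟩
        rw [hypForm_apply, pair_coe_hypProj]
        simp [hz])
    refine ⟨_, hw.cons hJ hef, fun i => ?_⟩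
    refine Fin.cases ?_ (fun i => ?_) i
    · simpa using he
    · simpa [IsReduction.coe_restrict] using congrArg Subtype.val (hwv i)

end Lifting

/-! ### Isometries that induce the identity modulo m -/

section Isometry

universe u v

/-- Glue `β` to the map `e ↦ e'`, `f ↦ f'` along the two orthogonal splittings. -/
theorem exists_isometry_of_hypCompl {Λ Λ' : Type u} [AddCommGroup Λ] [AddCommGroup Λ']
    {m : ℕ} {M : Type v} [AddCommGroup M] [Module (ZMod m) M]
    {J : LinearMap.BilinForm ℤ Λ} {J' : LinearMap.BilinForm ℤ Λ'}
    {B : LinearMap.BilinForm (ZMod m) M} {ρ : Λ →+ M} {ρ' : Λ' →+ M}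
    (h : IsReduction J B ρ) (h' : IsReduction J' B ρ') (hJ : J.IsAlt) (hJ' : J'.IsAlt)
    {e f : Λ} {e' f' : Λ'} (hef : J e f = 1) (hef' : J' e' f' = 1)
    (he : ρ' e' = ρ e) (hf : ρ' f' = ρ f)
    (β : hypCompl J e f ≃ₗ[ℤ] hypCompl J' e' f')
    (hβ : ∀ x y, hypForm J' e' f' (β x) (β y) = hypForm J e f x y)
    (hρ : ∀ x, ρ' (β x) = ρ x) :
    ∃ α : Λ ≃ₗ[ℤ] Λ', (∀ x y, J' (α x) (α y) = J x y) ∧ (∀ x, ρ' (α x) = ρ x) ∧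
      α e = e' ∧ ∀ k : hypCompl J e f, α k = β k := by
  let α : Λ ≃ₗ[ℤ] Λ' := (hypEquiv hJ hef).trans
    (((LinearEquiv.refl ℤ (ℤ × ℤ)).prodCongr β).trans (hypEquiv hJ' hef').symm)
  have hα : ∀ a b k, α ((hypEquiv hJ hef).symm ((a, b), k)) =
      (hypEquiv hJ' hef').symm ((a, b), β k) := fun a b k => by simp [α]
  refine ⟨α, fun x y => ?_, fun x => ?_, ?_, fun k => ?_⟩
  · obtain ⟨⟨⟨a, b⟩, k⟩, rfl⟩ := (hypEquiv hJ hef).symm.surjective x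
    obtain ⟨⟨⟨a', b'⟩, k'⟩, rfl⟩ := (hypEquiv hJ hef).symm.surjective y
    rw [hα, hα, pair_hypEquiv_symm, pair_hypEquiv_symm, hβ]
  · obtain ⟨⟨⟨a, b⟩, k⟩, rfl⟩ := (hypEquiv hJ hef).symm.surjective x
    rw [hα, hypEquiv_symm_apply, hypEquiv_symm_apply]
    simp only [map_add, h.map_smul, h'.map_smul, he, hf, hρ]
  · have := hα 1 0 0
    simpa [hypEquiv_symm_apply] using this
  · have := hα 0 0 k
    simpa [hypEquiv_symm_apply] using this

/-- Two unimodular lattices of the same rank with a common reduction modulo `m` are isometric by an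
isometry that induces the identity of the reduction and matches given frames. -/
theorem IsReduction.exists_isometry {m : ℕ} (n : ℕ) : ∀ {Λ Λ' : Type u} [AddCommGroup Λ]
    [Module.Free ℤ Λ] [Module.Finite ℤ Λ] [AddCommGroup Λ'] [Module.Free ℤ Λ'] [Module.Finite ℤ Λ']
    {M : Type v} [AddCommGroup M] [Module (ZMod m) M]
    {J : LinearMap.BilinForm ℤ Λ} {J' : LinearMap.BilinForm ℤ Λ'}
    {B : LinearMap.BilinForm (ZMod m) M} {ρ : Λ →+ M} {ρ' : Λ' →+ M},
    IsReduction J B ρ → IsReduction J' B ρ' → Function.Bijective J → Function.Bijective J' →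
    J.IsAlt → J'.IsAlt → Module.finrank ℤ Λ = n → Module.finrank ℤ Λ' = n →
    ∀ {p : ℕ} {v : Fin p → Λ} {v' : Fin p → Λ'}, IsFrame J v → IsFrame J' v' →
    (∀ i, ρ (v i) = ρ' (v' i)) →
    ∃ α : Λ ≃ₗ[ℤ] Λ', (∀ x y, J' (α x) (α y) = J x y) ∧ (∀ x, ρ' (α x) = ρ x) ∧
      ∀ i, α (v i) = v' i := by
  induction n using Nat.strong_induction_on with
  | _ n ih =>
  intro Λ Λ' _ _ _ _ _ _ M _ _ J J' B ρ ρ' h h' hu hu' hJ hJ' hn hn'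
  -- Nonempty frames: complete `v 0` and `v' 0` to hyperbolic pairs with the same reduction, each
  -- orthogonal to the rest of its frame, and apply induction to the complements. These are
  -- different lattices even if `Λ = Λ'`, which is why the statement has two.
  have step : ∀ {p : ℕ} {v : Fin (p + 1) → Λ} {v' : Fin (p + 1) → Λ'}, IsFrame J v →
      IsFrame J' v' → (∀ i, ρ (v i) = ρ' (v' i)) →
      ∃ α : Λ ≃ₗ[ℤ] Λ', (∀ x y, J' (α x) (α y) = J x y) ∧ (∀ x, ρ' (α x) = ρ x) ∧
        ∀ i, α (v i) = v' i := by
    intro p v v' hv hv' hvv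
    obtain ⟨f, hf⟩ := hv.split (Pi.single 0 1)
    have hef : J (v 0) f = 1 := by simp [hf]
    obtain ⟨f', hff, hf'⟩ := h'.exists_lift_pairing hv' (ρ f) (Pi.single 0 1) fun i => by
      rw [← hvv, h.map_form, hf]
    have hef' : J' (v' 0) f' = 1 := by simp [hf']
    have hk : ∀ i : Fin p, (hypProj hJ hef (v i.succ) : Λ) = v i.succ := fun i => by
      rw [hypProj_apply, hv.isotropic, ← hJ.neg_eq, hf]
      simp
    have hk' : ∀ i : Fin p, (hypProj hJ' hef' (v' i.succ) : Λ') = v' i.succ := fun i => by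
      rw [hypProj_apply, hv'.isotropic, ← hJ'.neg_eq, hf']
      simp
    have hr := finrank_hypCompl hJ hef
    have hr' := finrank_hypCompl hJ' hef'
    -- Both complements reduce to the same submodule, the complement of `ρ (v 0)` and `ρ f`.
    obtain ⟨β, hβ, hβρ, hβv⟩ := ih (n - 2) (by omega)
      (h.isReduction_restrict hJ hef rfl rfl)
      (h'.isReduction_restrict hJ' hef' (hvv 0).symm hff) (hypForm_bijective hJ hef hu)
      (hypForm_bijective hJ' hef' hu') (hypForm_isAlt hJ) (hypForm_isAlt hJ') (by omega) (by omega)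
      (hv.tail hJ hef) (hv'.tail hJ' hef') (fun i => Subtype.ext (by
        rw [IsReduction.coe_restrict, IsReduction.coe_restrict, hk, hk', hvv]))
    obtain ⟨α, hα, hαρ, hαe, hαk⟩ := exists_isometry_of_hypCompl h h' hJ hJ' hef hef'
      (hvv 0).symm hff β hβ (fun x => congrArg Subtype.val (hβρ x))
    refine ⟨α, hα, hαρ, fun i => ?_⟩
    refine Fin.cases hαe (fun i => ?_) i
    rw [← hk, hαk, hβv, hk']
  intro p v v' hv hv' hvv
  cases p with
  | succ p => exact step hv hv' hvv
  | zero =>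
    rcases Nat.eq_zero_or_pos n with rfl | hpos
    · have := Module.finrank_zero_iff.1 hn
      have := Module.finrank_zero_iff.1 hn'
      exact ⟨LinearEquiv.ofFinrankEq _ _ (hn.trans hn'.symm),
        fun x y => by rw [Subsingleton.elim x 0]; simp,
        fun x => by rw [Subsingleton.elim x 0]; simp, fun i => i.elim0⟩
    -- An empty frame in positive rank is replaced by a frame of length one: a primitive vector `e`
    -- and a primitive lift `e'` of its reduction.
    · obtain ⟨e, f, hef⟩ := exists_pair hu (hn ▸ hpos)
      obtain ⟨e', f', he, hef'⟩ := h'.exists_lift_primitive hu' hJ' (hn' ▸ hpos) (h.map_pair hef)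
      obtain ⟨α, hα, hαρ, -⟩ := step (v := fun _ : Fin 1 => e) (v' := fun _ => e')
        (isFrame_one hJ hef) (isFrame_one hJ' hef') (fun _ => he.symm)
      exact ⟨α, hα, hαρ, fun i => i.elim0⟩

end Isometry

/-! ### Matrices whose first column is the first unit vector -/

section Bordered

variable {R : Type*} [CommRing R] {n : ℕ}

/-- The block matrix with first column `(1, 0, …, 0)`, first row `(1, r)` and lower right block
`C`. -/
def bordered (r : Fin n → R) (C : Matrix (Fin n) (Fin n) R) :
    Matrix (Fin (n + 1)) (Fin (n + 1)) R :=
  Matrix.of (Fin.cons (Fin.cons 1 r) fun i => Fin.cons 0 (C i))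

theorem bordered_zero_zero (r : Fin n → R) (C : Matrix (Fin n) (Fin n) R) :
    bordered r C 0 0 = 1 := rfl

theorem bordered_zero_succ (r : Fin n → R) (C : Matrix (Fin n) (Fin n) R) (j : Fin n) :
    bordered r C 0 j.succ = r j := rfl

theorem bordered_succ_zero (r : Fin n → R) (C : Matrix (Fin n) (Fin n) R) (i : Fin n) :
    bordered r C i.succ 0 = 0 := rfl

theorem bordered_succ_succ (r : Fin n → R) (C : Matrix (Fin n) (Fin n) R) (i j : Fin n) :
    bordered r C i.succ j.succ = C i j := rfl

theorem bordered_column (r : Fin n → R) (C : Matrix (Fin n) (Fin n) R) (i : Fin (n + 1)) :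
    bordered r C i 0 = Pi.single (M := fun _ => R) 0 1 i := by
  refine Fin.cases ?_ (fun i => ?_) i
  · rw [bordered_zero_zero, Pi.single_eq_same]
  · rw [bordered_succ_zero, Pi.single_eq_of_ne (Fin.succ_ne_zero i)]

theorem det_bordered (r : Fin n → R) (C : Matrix (Fin n) (Fin n) R) :
    (bordered r C).det = C.det := by
  rw [Matrix.det_succ_column_zero, Fin.sum_univ_succ]
  simp only [bordered_zero_zero, bordered_succ_zero]
  simp only [Fin.val_zero, pow_zero, mul_one, one_mul, mul_zero, zero_mul, Finset.sum_const_zero,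
    add_zero]
  rfl

/-- `bordered` for invertible matrices. -/
noncomputable def borderedGL (r : Fin n → R) (C : GL (Fin n) R) : GL (Fin (n + 1)) R :=
  Matrix.GeneralLinearGroup.mk'' (bordered r C.1) (by
    rw [det_bordered]
    exact (Matrix.isUnit_iff_isUnit_det _).1 C.isUnit)

theorem coe_borderedGL (r : Fin n → R) (C : GL (Fin n) R) :
    (borderedGL r C : Matrix _ _ R) = bordered r C.1 := rfl

theorem borderedGL_injective {r r' : Fin n → R} {C C' : GL (Fin n) R}
    (h : borderedGL r C = borderedGL r' C') : r = r' ∧ C = C' := by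
  have h' := fun i j => congrArg (fun A : GL (Fin (n + 1)) R => A.1 i j) h
  exact ⟨funext fun j => h' 0 j.succ, Units.ext (Matrix.ext fun i j => h' i.succ j.succ)⟩

theorem exists_eq_bordered (A : Matrix (Fin (n + 1)) (Fin (n + 1)) R)
    (hA : ∀ i, A i 0 = Pi.single (M := fun _ => R) 0 1 i) : ∃ r C, A = bordered r C := by
  refine ⟨fun j => A 0 j.succ, A.submatrix Fin.succ Fin.succ, Matrix.ext fun i j => ?_⟩
  refine Fin.cases ?_ (fun j => ?_) j
  · rw [hA, bordered_column]
  · refine Fin.cases ?_ (fun i => ?_) i <;> rfl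

theorem exists_eq_borderedGL (A : GL (Fin (n + 1)) R)
    (hA : ∀ i, A.1 i 0 = Pi.single (M := fun _ => R) 0 1 i) :
    ∃ r C, A = borderedGL r C ∧ C.det = A.det := by
  obtain ⟨r, C, hC⟩ := exists_eq_bordered A.1 hA
  have hdet : C.det = A.1.det := by rw [hC, det_bordered]
  refine ⟨r, Matrix.GeneralLinearGroup.mk'' C ?_, Units.ext hC, Units.ext hdet⟩
  rw [hdet]
  exact (Matrix.isUnit_iff_isUnit_det _).1 A.isUnit

/-- A vector is unimodular if its coordinates generate the unit ideal. -/
def IsUnimodularVec {N : ℕ} (c : Fin N → R) : Prop := ∃ y, c ⬝ᵥ y = 1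

theorem isUnimodularVec_column (A : GL (Fin (n + 1)) R) : IsUnimodularVec fun i => A.1 i 0 := by
  refine ⟨fun i => (A⁻¹).1 0 i, ?_⟩
  have : ((A⁻¹ * A).1 : Matrix _ _ R) 0 0 = 1 := by
    rw [inv_mul_cancel, Units.val_one, Matrix.one_apply_eq]
  rw [Units.val_mul, Matrix.mul_apply] at this
  rw [dotProduct, ← this]
  exact Finset.sum_congr rfl fun i _ => mul_comm _ _

/-- Matrices with the same first column thus differ by a bordered one, which drives the inductions
on the size. -/
theorem column_inv_mul {P A : GL (Fin (n + 1)) R} (h : ∀ i, P.1 i 0 = A.1 i 0) (i : Fin (n + 1)) :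
    (P⁻¹ * A).1 i 0 = Pi.single (M := fun _ => R) 0 1 i := by
  have : ((P⁻¹ * P).1 : Matrix _ _ R) i 0 = Pi.single (M := fun _ => R) 0 1 i := by
    rw [inv_mul_cancel, Units.val_one, Matrix.one_apply, Pi.single_apply]
  rw [← this, Units.val_mul, Units.val_mul, Matrix.mul_apply, Matrix.mul_apply]
  exact Finset.sum_congr rfl fun j _ => by rw [h]

theorem column_mul_bordered (P : Matrix (Fin (n + 1)) (Fin (n + 1)) R) (r : Fin n → R)
    (C : Matrix (Fin n) (Fin n) R) (i : Fin (n + 1)) : (P * bordered r C) i 0 = P i 0 := by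
  rw [Matrix.mul_apply]
  simp [bordered_column, Pi.single_apply]

end Bordered

/-! ### Completing unimodular columns and lifting GL_n(ℤ/m) to GL_n(ℤ) -/

section Completion

/-- A primitive integral vector is the first column of an invertible matrix. -/
theorem exists_GL_int_column {N : ℕ} {x f : Fin (N + 1) → ℤ} (h : f ⬝ᵥ x = 1) :
    ∃ P : GL (Fin (N + 1)) ℤ, ∀ i, P.1 i 0 = x i := by
  let l : (Fin (N + 1) → ℤ) →ₗ[ℤ] ℤ := dotProductEquiv ℤ (Fin (N + 1)) f
  have hl : l x = 1 := h
  have hrange : LinearMap.range l = ⊤ :=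
    LinearMap.range_eq_top.2 fun a => ⟨a • x, by rw [map_smul, hl, smul_eq_mul, mul_one]⟩
  have hrank : Module.finrank ℤ (LinearMap.ker l) = N := by
    have h1 := Submodule.finrank_quotient_add_finrank (LinearMap.ker l)
    rw [l.quotKerEquivRange.finrank_eq, hrange, finrank_top, Module.finrank_self,
      Module.finrank_fin_fun] at h1
    omega
  -- Since `l x = 1`, the lattice is the direct sum of `ℤ x` and the kernel of `l`; `x` followed by
  -- a basis of the kernel is a basis, and its vectors are the columns of `P`.
  let b := Module.Basis.mkFinCons x (Module.finBasisOfFinrankEq ℤ (LinearMap.ker l) hrank)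
    (fun c z hz hc => by
      have := congrArg l hc
      rw [map_add, map_smul, hl, LinearMap.mem_ker.1 hz] at this
      simpa using this)
    (fun z => ⟨-l z, by rw [LinearMap.mem_ker, map_add, map_smul, hl]; simp⟩)
  refine ⟨⟨(Pi.basisFun ℤ _).toMatrix b, b.toMatrix (Pi.basisFun ℤ _),
    Module.Basis.toMatrix_mul_toMatrix_flip _ _, Module.Basis.toMatrix_mul_toMatrix_flip _ _⟩,
    fun i => ?_⟩
  change (Pi.basisFun ℤ _).repr (b 0) i = x i
  rw [Pi.basisFun_repr, Module.Basis.coe_mkFinCons, Fin.cons_zero]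

variable {m : ℕ}

theorem map_apply_GL {n : ℕ} (P : GL (Fin n) ℤ) (i j : Fin n) :
    (Matrix.GeneralLinearGroup.map (Int.castRingHom (ZMod m)) P).1 i j = (P.1 i j : ZMod m) := rfl

theorem det_map_GL_int {n : ℕ} (P : GL (Fin n) ℤ) :
    (Matrix.GeneralLinearGroup.map (Int.castRingHom (ZMod m)) P).det = 1 ∨
      (Matrix.GeneralLinearGroup.map (Int.castRingHom (ZMod m)) P).det = -1 := by
  have : (Matrix.GeneralLinearGroup.map (Int.castRingHom (ZMod m)) P).det =
      Units.map (Int.castRingHom (ZMod m)).toMonoidHom P.det :=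
    Units.ext ((Int.castRingHom (ZMod m)).map_det P.1).symm
  rcases Int.units_eq_one_or P.det with h | h
  · exact .inl (by rw [this, h, map_one])
  · refine .inr (by rw [this, h]; apply Units.ext; simp)

/-- A unimodular vector modulo `m` of length at least two is the reduction of the first column of
an invertible integral matrix. -/
theorem exists_GL_int_column_lift {N : ℕ} {c : Fin (N + 2) → ZMod m} (hc : IsUnimodularVec c) :
    ∃ P : GL (Fin (N + 2)) ℤ, ∀ i, (P.1 i 0 : ZMod m) = c i := by
  obtain ⟨y, hy⟩ := hc
  choose x hx using fun i => ZMod.intCast_surjective (c i)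
  choose z hz using fun i => ZMod.intCast_surjective (y i)
  have hxz : ((x ⬝ᵥ z : ℤ) : ZMod m) = 1 := by
    rw [← hy]
    simp [dotProduct, hx, hz]
  by_cases hx0 : x = 0
  · have h1 : (1 : ZMod m) = 0 := by rw [← hxz, hx0]; simp
    refine ⟨1, fun i => ?_⟩
    rw [← one_mul (c i), h1, zero_mul, ← mul_one (Int.cast _), h1, mul_zero]
  · obtain ⟨d, e, f, hde, hef⟩ := exists_eq_smul_primitive
      (J := (dotProductEquiv ℤ (Fin (N + 2))).toLinearMap) (dotProductEquiv ℤ _).bijective hx0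
    have hef' : f ⬝ᵥ e = 1 := by rw [dotProduct_comm]; exact hef
    obtain ⟨Q, hQ⟩ := exists_GL_int_column hef'
    have hdm : IsCoprime d (m : ℤ) := by
      have : ((d * (e ⬝ᵥ z) - 1 : ℤ) : ZMod m) = 0 := by
        rw [Int.cast_sub, Int.cast_one, sub_eq_zero, ← hxz, hde, smul_dotProduct, smul_eq_mul]
      rw [ZMod.intCast_zmod_eq_zero_iff_dvd] at this
      obtain ⟨k, hk⟩ := this
      exact ⟨e ⬝ᵥ z, -k, by linarith⟩
    obtain ⟨a, b, hab⟩ := hdm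
    have hQQ : ∀ i j, ∑ k, (Q⁻¹).1 i k * Q.1 k j = (1 : Matrix (Fin (N + 2)) _ ℤ) i j := by
      intro i j
      rw [← Matrix.mul_apply, ← Units.val_mul, inv_mul_cancel, Units.val_one]
    -- Here length at least two is needed: `d` times the first column of `Q` plus `m` times the
    -- second is primitive, because `d` and `m` are coprime, and it still reduces to `c`.
    obtain ⟨P, hP⟩ := exists_GL_int_column (x := fun i => d * Q.1 i 0 + m * Q.1 i 1)
      (f := fun i => a * (Q⁻¹).1 0 i + b * (Q⁻¹).1 1 i) (by
        have h00 := hQQ 0 0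
        have h01 := hQQ 0 1
        have h10 := hQQ 1 0
        have h11 := hQQ 1 1
        simp only [Matrix.one_apply_eq, Matrix.one_apply_ne, ne_eq, zero_ne_one, one_ne_zero,
          not_false_eq_true] at h00 h01 h10 h11
        calc _ = (a * d) * ∑ k, (Q⁻¹).1 0 k * Q.1 k 0 + (a * m) * ∑ k, (Q⁻¹).1 0 k * Q.1 k 1
            + (b * d) * ∑ k, (Q⁻¹).1 1 k * Q.1 k 0 + (b * m) * ∑ k, (Q⁻¹).1 1 k * Q.1 k 1 := by
              simp only [dotProduct, Finset.mul_sum, ← Finset.sum_add_distrib]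
              exact Finset.sum_congr rfl fun i _ => by ring
          _ = 1 := by rw [h00, h01, h10, h11]; linear_combination hab)
    refine ⟨P, fun i => ?_⟩
    rw [hP, hQ, ← hx, hde]
    simp

/-- A unimodular vector modulo `m` is the first column of an invertible matrix. -/
theorem exists_GL_column {N : ℕ} {c : Fin (N + 1) → ZMod m} (hc : IsUnimodularVec c) :
    ∃ P : GL (Fin (N + 1)) (ZMod m), ∀ i, P.1 i 0 = c i := by
  cases N with
  | zero =>
    obtain ⟨y, hy⟩ := hc
    refine ⟨Matrix.GeneralLinearGroup.mk'' (Matrix.of fun i _ => c i) ?_, fun i => rfl⟩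
    rw [Matrix.det_fin_one]
    exact IsUnit.of_mul_eq_one (y 0) (by simpa [dotProduct] using hy)
  | succ N =>
    obtain ⟨P, hP⟩ := exists_GL_int_column_lift hc
    exact ⟨Matrix.GeneralLinearGroup.map (Int.castRingHom (ZMod m)) P, hP⟩

/-- A matrix over `ℤ/m` with determinant `±1` lifts to an invertible integral matrix. -/
theorem exists_GL_int_lift (n : ℕ) : ∀ A : GL (Fin n) (ZMod m), A.det = 1 ∨ A.det = -1 →
    ∃ P : GL (Fin n) ℤ, Matrix.GeneralLinearGroup.map (Int.castRingHom (ZMod m)) P = A := by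
  induction n with
  | zero => exact fun A _ => ⟨1, Subsingleton.elim _ _⟩
  | succ n ih =>
    intro A hA
    cases n with
    | zero =>
      have hdet : ∀ B : GL (Fin 1) (ZMod m), (B.det : ZMod m) = B.1 0 0 :=
        fun B => Matrix.det_fin_one B.1
      obtain ⟨u, hu⟩ : ∃ u : ℤˣ, ((u : ℤ) : ZMod m) = A.1 0 0 := by
        rcases hA with hA | hA
        · exact ⟨1, by rw [← hdet, hA]; simp⟩
        · exact ⟨-1, by rw [← hdet, hA]; simp⟩
      refine ⟨Matrix.GeneralLinearGroup.mk'' (Matrix.of fun _ _ => (u : ℤ)) ?_,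
        Matrix.GeneralLinearGroup.ext fun i j => ?_⟩
      · rw [Matrix.det_fin_one]
        exact u.isUnit
      rw [map_apply_GL, show i = 0 from Fin.fin_one_eq_zero i, show j = 0 from Fin.fin_one_eq_zero j]
      exact hu
    | succ n =>
      obtain ⟨P, hP⟩ := exists_GL_int_column_lift (isUnimodularVec_column A)
      set P' := Matrix.GeneralLinearGroup.map (Int.castRingHom (ZMod m)) P with hP'
      -- Dividing by an integral matrix with the same first column modulo m leaves a bordered
      -- matrix, whose block `C` again has determinant ±1.
      obtain ⟨r, C, hC, hdet⟩ := exists_eq_borderedGL (P'⁻¹ * A) (column_inv_mul hP)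
      have hdetP : P'.det = 1 ∨ P'.det = -1 := det_map_GL_int P
      obtain ⟨D, hD⟩ := ih C (by
        rw [hdet, map_mul, map_inv]
        rcases hdetP with h | h <;> rcases hA with h' | h' <;> simp [h, h'])
      choose s hs using fun i => ZMod.intCast_surjective (r i)
      refine ⟨P * borderedGL s D, ?_⟩
      have : Matrix.GeneralLinearGroup.map (Int.castRingHom (ZMod m)) (borderedGL s D) =
          borderedGL r C := by
        refine Matrix.GeneralLinearGroup.ext fun i j => ?_
        rw [map_apply_GL, coe_borderedGL, coe_borderedGL, ← hD]
        refine Fin.cases ?_ (fun i => ?_) i <;> refine Fin.cases ?_ (fun j => ?_) j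
        · simp [bordered_zero_zero]
        · simp [bordered_zero_succ, hs]
        · simp [bordered_succ_zero]
        · simp [bordered_succ_succ]
      rw [map_mul, this, ← hP', ← hC, mul_inv_cancel_left]

end Completion

/-! ### Recursion for the order of GL_n(ℤ/m) -/

section Count

variable {m : ℕ}

/-- After fixing for each unimodular `c` a matrix `P c` with first column `c`, every invertible
matrix is uniquely `P c` times a bordered one. -/
theorem card_GL_succ (n : ℕ) [NeZero m] : Nat.card (GL (Fin (n + 1)) (ZMod m)) =
    Nat.card {c : Fin (n + 1) → ZMod m // IsUnimodularVec c} * m ^ n *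
      Nat.card (GL (Fin n) (ZMod m)) := by
  choose P hP using fun c : {c : Fin (n + 1) → ZMod m // IsUnimodularVec c} =>
    exists_GL_column c.2
  have hcol : ∀ c r C i, (P c * borderedGL r C).1 i 0 = c.1 i := fun c r C i => by
    rw [Units.val_mul, coe_borderedGL, column_mul_bordered, hP]
  rw [← Nat.card_congr (Equiv.ofBijective
    (fun t : ({c : Fin (n + 1) → ZMod m // IsUnimodularVec c} × (Fin n → ZMod m)) ×
      GL (Fin n) (ZMod m) => P t.1.1 * borderedGL t.1.2 t.2) ⟨?_, fun A => ?_⟩)]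
  · simp [Nat.card_prod]
  · rintro ⟨⟨c, r⟩, C⟩ ⟨⟨c', r'⟩, C'⟩ h
    have hc : c = c' := Subtype.ext (funext fun i => by
      rw [← hcol c r C, ← hcol c' r' C']
      exact congrArg (fun A : GL (Fin (n + 1)) (ZMod m) => A.1 i 0) h)
    subst hc
    obtain ⟨rfl, rfl⟩ := borderedGL_injective (mul_left_cancel h)
    rfl
  · obtain ⟨r, C, hC, -⟩ := exists_eq_borderedGL ((P ⟨_, isUnimodularVec_column A⟩)⁻¹ * A)
      (column_inv_mul fun i => hP ⟨_, isUnimodularVec_column A⟩ i)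
    exact ⟨((⟨_, isUnimodularVec_column A⟩, r), C), by
      change P _ * borderedGL r C = A
      rw [← hC, mul_inv_cancel_left]⟩

end Count

/-! ### Counting unimodular vectors modulo m -/

section UnimodularCount

variable {R S : Type*} [CommRing R] [CommRing S]

theorem isUnimodularVec_iff_exists_isUnit [IsLocalRing R] {N : ℕ} {c : Fin N → R} :
    IsUnimodularVec c ↔ ∃ i, IsUnit (c i) := by
  constructor
  · rintro ⟨y, hy⟩
    by_contra! h
    have : c ⬝ᵥ y ∈ IsLocalRing.maximalIdeal R :=
      Ideal.sum_mem _ fun i _ => Ideal.mul_mem_right _ _ (h i)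
    rw [hy] at this
    exact this isUnit_one
  · rintro ⟨i, u, hu⟩
    refine ⟨Pi.single i (u⁻¹ : Rˣ).1, ?_⟩
    rw [dotProduct_single, ← hu, Units.mul_inv]

theorem IsUnimodularVec.map {N : ℕ} {c : Fin N → R} (h : IsUnimodularVec c) (φ : R →+* S) :
    IsUnimodularVec fun i => φ (c i) := by
  obtain ⟨y, hy⟩ := h
  refine ⟨fun i => φ (y i), ?_⟩
  rw [← map_one φ, ← hy]
  simp [dotProduct]

theorem isUnimodularVec_prod {N : ℕ} {c : Fin N → R × S} :
    IsUnimodularVec c ↔ IsUnimodularVec (fun i => (c i).1) ∧ IsUnimodularVec fun i => (c i).2 := by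
  refine ⟨fun h => ⟨h.map (RingHom.fst R S), h.map (RingHom.snd R S)⟩, ?_⟩
  rintro ⟨⟨y, hy⟩, z, hz⟩
  refine ⟨fun i => (y i, z i), Prod.ext ?_ ?_⟩
  · simpa [dotProduct, Prod.fst_sum] using hy
  · simpa [dotProduct, Prod.snd_sum] using hz

theorem card_unimodularVec_mul {a b : ℕ} (hab : a.Coprime b) (N : ℕ) :
    Nat.card {c : Fin N → ZMod (a * b) // IsUnimodularVec c} =
      Nat.card {c : Fin N → ZMod a // IsUnimodularVec c} *
        Nat.card {c : Fin N → ZMod b // IsUnimodularVec c} := by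
  let e := ZMod.chineseRemainder hab
  rw [← Nat.card_prod]
  refine Nat.card_congr (Equiv.ofBijective (fun c =>
    (⟨fun i => (e (c.1 i)).1, c.2.map ((RingHom.fst _ _).comp e.toRingHom)⟩,
      ⟨fun i => (e (c.1 i)).2, c.2.map ((RingHom.snd _ _).comp e.toRingHom)⟩)) ⟨?_, ?_⟩)
  · rintro ⟨c, hc⟩ ⟨c', hc'⟩ h
    obtain ⟨h1, h2⟩ := Prod.ext_iff.1 h
    exact Subtype.ext (funext fun i => e.injective (Prod.ext
      (congrFun (congrArg Subtype.val h1) i) (congrFun (congrArg Subtype.val h2) i)))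
  · rintro ⟨⟨y, hy⟩, z, hz⟩
    have h := (isUnimodularVec_prod (c := fun i => (y i, z i))).2 ⟨hy, hz⟩
    refine ⟨⟨_, h.map e.symm.toRingHom⟩, Prod.ext (Subtype.ext (funext fun i => ?_))
      (Subtype.ext (funext fun i => ?_))⟩
    · exact congrArg Prod.fst (e.apply_symm_apply (y i, z i))
    · exact congrArg Prod.snd (e.apply_symm_apply (y i, z i))

/-- Over a local ring the vectors that are not unimodular are those with no unit entry. -/
theorem card_unimodularVec_add [Finite R] [IsLocalRing R] (N : ℕ) :
    Nat.card {c : Fin N → R // IsUnimodularVec c} + Nat.card {x : R // ¬ IsUnit x} ^ N =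
      Nat.card R ^ N := by
  classical
  have h1 : Nat.card {c : Fin N → R // ¬ IsUnimodularVec c} =
      Nat.card {x : R // ¬ IsUnit x} ^ N := by
    have e : {c : Fin N → R // ¬ IsUnimodularVec c} ≃ (Fin N → {x : R // ¬ IsUnit x}) :=
      (Equiv.subtypeEquivRight fun c => by
        rw [isUnimodularVec_iff_exists_isUnit, not_exists]).trans Equiv.subtypePiEquivPi
    rw [Nat.card_congr e, Nat.card_pi]
    simp
  rw [← h1, ← Nat.card_sum, Nat.card_congr (Equiv.sumCompl _), Nat.card_pi]
  simp

theorem card_unimodularVec_prime_pow {q k N : ℕ} (hq : q.Prime) (hk : 0 < k) :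
    (Nat.card {c : Fin N → ZMod (q ^ k) // IsUnimodularVec c} : ℚ) =
      ((q ^ k : ℕ) : ℚ) ^ N * (1 - 1 / (q : ℚ) ^ N) := by
  have : Fact q.Prime := ⟨hq⟩
  have : NeZero k := ⟨hk.ne'⟩
  have : Fact (1 < q ^ k) := ⟨Nat.one_lt_pow hk.ne' hq.one_lt⟩
  -- The nonunits are the classes of multiples of `q`, hence closed under addition.
  have hloc : IsLocalRing (ZMod (q ^ k)) := by
    have key : ∀ a : ℕ, (a : ZMod (q ^ k)) ∈ nonunits _ ↔ q ∣ a := fun a => by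
      rw [mem_nonunits_iff, ZMod.isUnit_iff_coprime, Nat.coprime_pow_right_iff hk,
        Nat.coprime_comm, hq.coprime_iff_not_dvd, not_not]
    refine .of_nonunits_add fun a b ha hb => ?_
    obtain ⟨a, rfl⟩ := ZMod.natCast_zmod_surjective a
    obtain ⟨b, rfl⟩ := ZMod.natCast_zmod_surjective b
    rw [key] at ha hb
    rw [← Nat.cast_add, key]
    exact dvd_add ha hb
  have hnon : Nat.card {x : ZMod (q ^ k) // ¬ IsUnit x} = q ^ (k - 1) := by
    classical
    have h2 : Nat.card {x : ZMod (q ^ k) // IsUnit x} = q ^ (k - 1) * (q - 1) := by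
      rw [← Nat.totient_prime_pow hq hk, ← ZMod.card_units_eq_totient, ← Nat.card_eq_fintype_card]
      let e : (ZMod (q ^ k))ˣ → {x : ZMod (q ^ k) // IsUnit x} := fun u => ⟨u.1, u.isUnit⟩
      have he : Function.Bijective e := ⟨fun u v h => Units.ext (congrArg Subtype.val h),
        fun ⟨x, u, hu⟩ => ⟨u, Subtype.ext hu⟩⟩
      exact (Nat.card_congr (Equiv.ofBijective e he)).symm
    have h3 : Nat.card {x : ZMod (q ^ k) // IsUnit x} +
        Nat.card {x : ZMod (q ^ k) // ¬ IsUnit x} = q ^ k := by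
      rw [← Nat.card_sum, Nat.card_congr (Equiv.sumCompl _), Nat.card_zmod]
    obtain ⟨k, rfl⟩ : ∃ j, k = j + 1 := ⟨k - 1, by omega⟩
    obtain ⟨r, rfl⟩ : ∃ j, q = j + 1 := ⟨q - 1, by have := hq.pos; omega⟩
    rw [h2, pow_succ, Nat.add_sub_cancel, Nat.add_sub_cancel] at h3
    rw [mul_add, mul_one] at h3
    rw [Nat.add_sub_cancel]
    exact Nat.add_left_cancel h3
  have h := card_unimodularVec_add (R := ZMod (q ^ k)) N
  rw [hnon, Nat.card_zmod] at h
  have hq0 : (q : ℚ) ≠ 0 := by exact_mod_cast hq.ne_zero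
  obtain ⟨k, rfl⟩ : ∃ j, k = j + 1 := ⟨k - 1, by omega⟩
  have h' := congrArg (Nat.cast : ℕ → ℚ) h
  push_cast at h' ⊢
  rw [← eq_sub_iff_add_eq] at h'
  rw [h', pow_succ, mul_pow]
  field_simp

/-- The number of unimodular vectors over `ℤ/m`. -/
theorem card_unimodularVec (N : ℕ) {m : ℕ} (hm : 0 < m) :
    (Nat.card {c : Fin N → ZMod m // IsUnimodularVec c} : ℚ) =
      (m : ℚ) ^ N * ∏ q ∈ m.primeFactors, (1 - 1 / (q : ℚ) ^ N) := by
  induction m using Nat.recOnPosPrimePosCoprime with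
  | zero => exact absurd hm (lt_irrefl 0)
  | one =>
    have : Nat.card {c : Fin N → ZMod 1 // IsUnimodularVec c} = 1 :=
      Nat.card_eq_one_iff_unique.2 ⟨inferInstance, ⟨⟨0, 0, Subsingleton.elim _ _⟩⟩⟩
    simp [this]
  | prime_pow q k hq hk =>
    rw [card_unimodularVec_prime_pow hq hk, Nat.primeFactors_prime_pow hk.ne' hq,
      Finset.prod_singleton]
  | coprime a b ha hb hab iha ihb =>
    rw [card_unimodularVec_mul hab, Nat.cast_mul, iha (by omega), ihb (by omega),
      hab.primeFactors_mul, Finset.prod_union hab.disjoint_primeFactors, Nat.cast_mul, mul_pow]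
    ring

end UnimodularCount

/-! ### Matrices of determinant ±1 and their index -/

section Determinant

/-- The invertible matrices over `ℤ/m` with determinant `±1`. -/
def detPlusMinusOne (n m : ℕ) : Subgroup (GL (Fin n) (ZMod m)) :=
  (Subgroup.zpowers (-1)).comap Matrix.GeneralLinearGroup.det

theorem zpowers_neg_one {m : ℕ} (u : (ZMod m)ˣ) :
    u ∈ Subgroup.zpowers (-1 : (ZMod m)ˣ) ↔ u = 1 ∨ u = -1 := by
  constructor
  · rintro ⟨k, rfl⟩
    rcases k.even_or_odd with h | h
    · exact .inl h.neg_one_zpow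
    · exact .inr h.neg_one_zpow
  · rintro (rfl | rfl)
    · exact one_mem _
    · exact Subgroup.mem_zpowers _

theorem mem_detPlusMinusOne {n m : ℕ} {A : GL (Fin n) (ZMod m)} :
    A ∈ detPlusMinusOne n m ↔ A.det = 1 ∨ A.det = -1 :=
  zpowers_neg_one _

theorem mem_detPlusMinusOne_iff_exists {n m : ℕ} {A : GL (Fin n) (ZMod m)} :
    A ∈ detPlusMinusOne n m ↔
      ∃ P : GL (Fin n) ℤ, Matrix.GeneralLinearGroup.map (Int.castRingHom (ZMod m)) P = A := by
  rw [mem_detPlusMinusOne]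
  refine ⟨exists_GL_int_lift n A, ?_⟩
  rintro ⟨P, rfl⟩
  exact det_map_GL_int P

/-- The origin of ε_m: -1 has order 1 for m = 1, 2 and order 2 otherwise. -/
theorem index_zpowers_neg_one {m : ℕ} (hm : 1 ≤ m) :
    ((Subgroup.zpowers (-1 : (ZMod m)ˣ)).index : ℚ) = epsilon m * m.totient := by
  have : NeZero m := ⟨by omega⟩
  have h := (Subgroup.zpowers (-1 : (ZMod m)ˣ)).index_mul_card
  rw [Nat.card_zpowers, Nat.card_eq_fintype_card, ZMod.card_units_eq_totient, ← orderOf_units,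
    Units.val_neg, Units.val_one] at h
  rw [← h]
  rcases hm.eq_or_lt with rfl | hm
  · rw [Subsingleton.elim (-1 : ZMod 1) 1, orderOf_one]
    simp [epsilon]
  · have : Fact (1 < m) := ⟨hm⟩
    rw [orderOf_neg_one, ZMod.ringChar_zmod_n, epsilon]
    by_cases h2 : m = 2
    · simp [h2]
    · rw [if_neg h2, if_neg (by omega)]
      push_cast
      ring

/-- For `n ≥ 1` the determinant is surjective, so the index of `detPlusMinusOne` is that of {±1} in
the units. -/
theorem card_GL_eq {n m : ℕ} (hn : 1 ≤ n) (hm : 1 ≤ m) :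
    (Nat.card (GL (Fin n) (ZMod m)) : ℚ) =
      epsilon m * m.totient * Nat.card (detPlusMinusOne n m) := by
  have : Nonempty (Fin n) := ⟨⟨0, hn⟩⟩
  rw [← index_zpowers_neg_one hm, ← Subgroup.index_comap_of_surjective _
    (Matrix.GeneralLinearGroup.det_surjective (n := Fin n)), ← Nat.cast_mul]
  exact congrArg _ (Subgroup.index_mul_card _).symm

end Determinant

/-! ### Counting frames modulo m -/

section FrameCount

universe u v

variable {Λ : Type u} [AddCommGroup Λ] {m : ℕ}
  {M : Type v} [AddCommGroup M] [Module (ZMod m) M]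
  {J : LinearMap.BilinForm ℤ Λ} {B : LinearMap.BilinForm (ZMod m) M} {ρ : Λ →+ M}

theorem IsReduction.surjective_coordinates (h : IsReduction J B ρ) {N : ℕ}
    (b : Module.Basis (Fin N) ℤ Λ) :
    Function.Surjective fun c : Fin N → ZMod m => ∑ i, c i • ρ (b i) := by
  intro x
  obtain ⟨x, rfl⟩ := h.surjective x
  refine ⟨fun i => b.repr x i, ?_⟩
  conv_rhs => rw [← b.sum_repr x]
  simp only [map_sum, h.map_smul]

theorem IsReduction.exists_pairing_basis (h : IsReduction J B ρ) (hu : Function.Bijective J)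
    (hJ : J.IsAlt) {N : ℕ} (b : Module.Basis (Fin N) ℤ Λ) (d : Fin N → ZMod m) :
    ∃ y, ∀ i, B (ρ (b i)) y = d i := by
  choose d' hd' using fun i => ZMod.intCast_surjective (d i)
  obtain ⟨z, hz⟩ := hu.2 (-(b.constr ℤ d'))
  refine ⟨ρ z, fun i => ?_⟩
  rw [h.map_form, ← hJ.neg_eq, hz, LinearMap.neg_apply, neg_neg, b.constr_basis, hd']

variable [Module.Free ℤ Λ] [Module.Finite ℤ Λ]

theorem IsReduction.finite [NeZero m] (h : IsReduction J B ρ) : Finite M :=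
  Finite.of_surjective _ (h.surjective_coordinates (Module.finBasis ℤ Λ))

/-- In coordinates for a lattice basis, the pairings with that basis take arbitrary values; so
pairing to 1 with some vector means having unimodular coordinates. -/
theorem IsReduction.card_unimodular (h : IsReduction J B ρ) (hu : Function.Bijective J)
    (hJ : J.IsAlt) : Nat.card {x : M // ∃ y, B x y = 1} =
      Nat.card {c : Fin (Module.finrank ℤ Λ) → ZMod m // IsUnimodularVec c} := by
  let b := Module.finBasis ℤ Λ
  have hpair : ∀ (c : Fin (Module.finrank ℤ Λ) → ZMod m) y,
      B (∑ i, c i • ρ (b i)) y = c ⬝ᵥ fun i => B (ρ (b i)) y := fun c y => by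
    simp [LinearMap.sum_apply, dotProduct]
  have hiff : ∀ c : Fin (Module.finrank ℤ Λ) → ZMod m,
      IsUnimodularVec c ↔ ∃ y, B (∑ i, c i • ρ (b i)) y = 1 := fun c => by
    constructor
    · rintro ⟨d, hd⟩
      obtain ⟨y, hy⟩ := h.exists_pairing_basis hu hJ b d
      exact ⟨y, by rw [hpair, ← hd]; simp only [hy]⟩
    · rintro ⟨y, hy⟩
      exact ⟨_, (hpair c y).symm.trans hy⟩
  have hbij : Function.Bijective fun c : Fin (Module.finrank ℤ Λ) → ZMod m =>
      ∑ i, c i • ρ (b i) := by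
    refine ⟨fun c c' hc => funext fun i => ?_, h.surjective_coordinates b⟩
    obtain ⟨y, hy⟩ := h.exists_pairing_basis hu hJ b (Pi.single i 1)
    have := congrArg (fun x => B x y) hc
    simp only [hpair, hy] at this
    simpa using this
  exact (Nat.card_congr ((Equiv.ofBijective _ hbij).subtypeEquiv hiff)).symm

/-- Frames are counted by their first vector, the multiples of it by which the other vectors differ
from a frame of a complement, and that frame. -/
theorem IsReduction.card_frame_succ [NeZero m] (h : IsReduction J B ρ) (hu : Function.Bijective J)
    (hJ : J.IsAlt) (hn : 0 < Module.finrank ℤ Λ) {p X : ℕ}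
    (hX : ∀ e f : Λ, J e f = 1 → Nat.card {k : Fin p → hypCompl B (ρ e) (ρ f) //
      IsFrame (hypForm B (ρ e) (ρ f)) k} = X) :
    Nat.card {w : Fin (p + 1) → M // IsFrame B w} =
      Nat.card {c : Fin (Module.finrank ℤ Λ) → ZMod m // IsUnimodularVec c} * m ^ p * X := by
  classical
  have hfin := h.finite
  have hB := h.isAlt hJ
  -- The pair is taken from the lattice, so that its complement modulo m is again a reduction and
  -- `hX` applies.
  have hlift : ∀ x : {x : M // ∃ y, B x y = 1}, ∃ e f, ρ e = x.1 ∧ J e f = 1 := fun x => by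
    obtain ⟨y, hy⟩ := x.2
    exact h.exists_lift_primitive hu hJ hn hy
  choose e f he hef using hlift
  have hef' : ∀ x : {x : M // ∃ y, B x y = 1}, B x.1 (ρ (f x)) = 1 := fun x => by
    rw [← he, h.map_pair (hef x)]
  let T (x : {x : M // ∃ y, B x y = 1}) : Type v := (Fin p → ZMod m) ×
    {k : Fin p → hypCompl B x.1 (ρ (f x)) // IsFrame (hypForm B x.1 (ρ (f x))) k}
  let φ (t : Σ x, T x) : {w : Fin (p + 1) → M // IsFrame B w} :=
    ⟨_, t.2.2.2.cons_add hB (hef' t.1) t.2.1⟩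
  have hφ : Function.Bijective φ := by
    constructor
    · rintro ⟨x, a, k, hk⟩ ⟨x', a', k', hk'⟩ hφ
      have hv := congrArg Subtype.val hφ
      have hx : x = x' := Subtype.ext (congrFun hv 0)
      subst hx
      have hs : ∀ i : Fin p, a i • x.1 + (k i : M) = a' i • x.1 + (k' i : M) :=
        fun i => congrFun hv i.succ
      -- Pairing with `ρ (f x)` recovers the coefficient of the first vector.
      have hpf : ∀ (c : ZMod m) (l : hypCompl B x.1 (ρ (f x))),
          B (c • x.1 + l) (ρ (f x)) = c := fun c l => by
        have hl : B l (ρ (f x)) = 0 := by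
          rw [← hB.neg_eq, (mem_hypCompl.1 l.2).2, neg_zero]
        simp [hef' x, hl]
      have ha : a = a' := funext fun i => by rw [← hpf (a i) (k i), hs, hpf]
      subst ha
      have hkk : k = k' := funext fun i => Subtype.ext (add_left_cancel (hs i))
      subst hkk
      rfl
    · rintro ⟨w, hw⟩
      obtain ⟨y, hy⟩ := hw.split (Pi.single 0 1)
      let x : {x : M // ∃ y, B x y = 1} := ⟨w 0, y, by simp [hy]⟩
      refine ⟨⟨x, fun i => -B (ρ (f x)) (w i.succ), _, hw.tail hB (hef' x)⟩,
        Subtype.ext (funext fun i => ?_)⟩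
      refine Fin.cases rfl (fun i => ?_) i
      change -B (ρ (f x)) (w i.succ) • w 0 + (hypProj hB (hef' x) (w i.succ) : M) = w i.succ
      rw [hypProj_apply]
      simp [x, hw.isotropic]
  have hT : ∀ x, Nat.card (T x) = m ^ p * X := fun x => by
    have := hX (e x) (f x) (hef x)
    rw [he] at this
    rw [Nat.card_prod, this, Nat.card_pi]
    simp
  have := Fintype.ofFinite {x : M // ∃ y, B x y = 1}
  rw [← Nat.card_congr (Equiv.ofBijective φ hφ), Nat.card_sigma]
  simp only [hT, Finset.sum_const, Finset.card_univ, smul_eq_mul]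
  rw [← Nat.card_eq_fintype_card, h.card_unimodular hu hJ, mul_assoc]

end FrameCount

/-- The number of isotropic frames of maximal length, compared with the order of the general linear
group. -/
theorem IsReduction.card_frame_maximal {m : ℕ} [NeZero m] (n : ℕ) :
    ∀ {Λ : Type*} [AddCommGroup Λ] [Module.Free ℤ Λ] [Module.Finite ℤ Λ]
      {M : Type*} [AddCommGroup M] [Module (ZMod m) M]
      {J : LinearMap.BilinForm ℤ Λ} {B : LinearMap.BilinForm (ZMod m) M} {ρ : Λ →+ M},
      IsReduction J B ρ → Function.Bijective J → J.IsAlt → Module.finrank ℤ Λ = 2 * n →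
      (Nat.card {w : Fin n → M // IsFrame B w} : ℚ) =
        (m : ℚ) ^ (n * (n + 1) / 2) *
          (∏ q ∈ m.primeFactors, ∏ i ∈ Finset.Icc 1 n, (1 + 1 / (q : ℚ) ^ i)) *
            Nat.card (GL (Fin n) (ZMod m)) := by
  induction n with
  | zero =>
    intro Λ _ _ _ M _ _ J B ρ h hu hJ hn
    have h1 : Nat.card {w : Fin 0 → M // IsFrame B w} = 1 := Nat.card_eq_one_iff_unique.2
      ⟨inferInstance, ⟨⟨Fin.elim0, fun i => i.elim0, fun c => ⟨0, fun i => i.elim0⟩⟩⟩⟩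
    simp [h1]
  | succ n ih =>
    intro Λ _ _ _ M _ _ J B ρ h hu hJ hn
    have hX : ∀ e f : Λ, J e f = 1 → (Nat.card {k : Fin n → hypCompl B (ρ e) (ρ f) //
      IsFrame (hypForm B (ρ e) (ρ f)) k} : ℚ) = _ := fun e f hef =>
        ih (h.isReduction_restrict hJ hef rfl rfl) (hypForm_bijective hJ hef hu)
          (hypForm_isAlt hJ) (by have := finrank_hypCompl hJ hef; omega)
    obtain ⟨e, f, hef⟩ := exists_pair hu (by omega)
    -- The inductive formula does not involve the pair, so the number of frames is the same for all
    -- complements.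
    rw [h.card_frame_succ hu hJ (by omega) (fun e' f' hef' => by
      exact_mod_cast (hX e' f' hef').trans (hX e f hef).symm), card_GL_succ]
    have hm : 0 < m := NeZero.pos m
    push_cast
    rw [hX e f hef, card_unimodularVec _ hm, card_unimodularVec _ hm, hn]
    -- The difference of squares reduces the quotient of the unimodular counts for lengths `2 * (n +
    -- 1)` and `n + 1` to the new factor.
    have hprod : ∏ q ∈ m.primeFactors, (1 - 1 / (q : ℚ) ^ (2 * (n + 1))) =
        (∏ q ∈ m.primeFactors, (1 - 1 / (q : ℚ) ^ (n + 1))) *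
          ∏ q ∈ m.primeFactors, (1 + 1 / (q : ℚ) ^ (n + 1)) := by
      rw [← Finset.prod_mul_distrib]
      refine Finset.prod_congr rfl fun q _ => ?_
      rw [two_mul, pow_add]
      ring
    have hexp : (n + 1) * (n + 1 + 1) / 2 = n * (n + 1) / 2 + (n + 1) := by
      rw [show (n + 1) * (n + 1 + 1) = n * (n + 1) + (n + 1) * 2 by ring,
        Nat.add_mul_div_right _ _ two_pos]
    rw [hprod, hexp]
    simp_rw [Finset.prod_Icc_succ_top (Nat.le_add_left 1 n)]
    rw [Finset.prod_mul_distrib, pow_add, two_mul, pow_add]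
    ring

/-! ### Spans of frames and counting by fibres -/

section GenericFrames

variable {R M : Type*} [CommRing R] [AddCommGroup M] [Module R M] {B : LinearMap.BilinForm R M}
  {p : ℕ} {v : Fin p → M}

theorem IsFrame.span_isotropic (h : IsFrame B v) {x y : M}
    (hx : x ∈ Submodule.span R (Set.range v)) (hy : y ∈ Submodule.span R (Set.range v)) :
    B x y = 0 := by
  obtain ⟨a, rfl⟩ := (Submodule.mem_span_range_iff_exists_fun R).1 hx
  obtain ⟨b, rfl⟩ := (Submodule.mem_span_range_iff_exists_fun R).1 hy
  simp [LinearMap.sum_apply, h.isotropic]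

theorem IsFrame.exists_isCompl (h : IsFrame B v) :
    ∃ W', IsCompl (Submodule.span R (Set.range v)) W' := by
  choose f hf using fun i => h.split (Pi.single i 1)
  -- With `f i` dual to the frame, `x ↦ ∑ B x (f i) • v i` is a projection onto the span.
  let π : M →ₗ[R] Submodule.span R (Set.range v) :=
    ∑ i, (B.flip (f i)).smulRight ⟨v i, Submodule.subset_span ⟨i, rfl⟩⟩
  refine ⟨_, LinearMap.isCompl_of_proj (f := π) fun x => Subtype.ext ?_⟩
  obtain ⟨a, ha⟩ := (Submodule.mem_span_range_iff_exists_fun R).1 x.2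
  have hB : ∀ i, B x (f i) = a i := fun i => by
    rw [← ha]
    simp [LinearMap.sum_apply, hf, Pi.single_apply]
  simp [π, LinearMap.sum_apply, hB, ha]

/-- Applied to frames modulo m in two ways: over isotropic summands and over orbits of rational
subspaces. -/
theorem card_eq_mul_of_fibers {F Q H : Type*} (f : F → Q) (hf : Function.Surjective f)
    (act : H → F → F) (hinj : ∀ v, Function.Injective fun h => act h v)
    (hfib : ∀ v w, f v = f w ↔ ∃ h, w = act h v) :
    Nat.card F = Nat.card Q * Nat.card H := by
  choose s hs using hf
  rw [← Nat.card_prod]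
  refine (Nat.card_congr (Equiv.ofBijective (fun t : Q × H => act t.2 (s t.1)) ⟨?_, fun w => ?_⟩)).symm
  · rintro ⟨q, h⟩ ⟨q', h'⟩ heq
    have hq : q = q' := by
      rw [← hs q, ← hs q', (hfib (s q) _).2 ⟨h, rfl⟩, (hfib (s q') _).2 ⟨h', rfl⟩]
      exact congrArg f heq
    subst hq
    exact Prod.ext rfl (hinj _ heq)
  · obtain ⟨h, hh⟩ := (hfib (s (f w)) w).1 (hs _)
    exact ⟨(f w, h), hh.symm⟩

end GenericFrames

/-! ### Isotropic summands modulo m -/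

section ModFrames

variable {Λ : Type*} [AddCommGroup Λ] (J : LinearMap.BilinForm ℤ Λ) (m : ℕ)

variable (Λ) in
/-- The reduction map of a lattice modulo `m`. -/
noncomputable def reduce : Λ →+ ZMod m ⊗[ℤ] Λ := (TensorProduct.mk ℤ (ZMod m) Λ 1).toAddMonoidHom

theorem reduce_apply (x : Λ) : reduce Λ m x = 1 ⊗ₜ[ℤ] x := rfl

variable [Module.Free ℤ Λ]

theorem isReduction_reduce : IsReduction J (J.baseChange (ZMod m)) (reduce Λ m) := by
  refine ⟨fun t => ?_, fun x hx => ?_, fun x y => ?_⟩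
  · induction t using TensorProduct.induction_on with
    | zero => exact ⟨0, map_zero _⟩
    | add s t hs ht =>
      obtain ⟨x, rfl⟩ := hs
      obtain ⟨y, rfl⟩ := ht
      exact ⟨x + y, map_add _ _ _⟩
    | tmul a x =>
      obtain ⟨a, rfl⟩ := ZMod.intCast_surjective a
      refine ⟨a • x, ?_⟩
      rw [reduce_apply, TensorProduct.tmul_smul, TensorProduct.smul_tmul', zsmul_eq_mul, mul_one]
  · let b := Module.Free.chooseBasis ℤ Λ
    have hdvd : ∀ i, ∃ c, b.repr x i = m * c := fun i => by
      have := congrArg (fun t => (b.baseChange (ZMod m)).repr t i) hx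
      simp only [reduce_apply, Module.Basis.baseChange_repr_tmul, map_zero, Finsupp.zero_apply,
        zsmul_eq_mul, mul_one] at this
      exact (ZMod.intCast_zmod_eq_zero_iff_dvd _ _).1 this
    choose c hc using hdvd
    refine ⟨∑ i ∈ (b.repr x).support, c i • b i, ?_⟩
    conv_lhs => rw [← b.linearCombination_repr x, Finsupp.linearCombination_apply, Finsupp.sum]
    rw [Finset.smul_sum]
    exact Finset.sum_congr rfl fun i _ => by rw [hc, mul_smul]
  · simp [reduce_apply]

variable {J m} {p : ℕ}

/-- The isotropic summand spanned by a frame modulo `m`. -/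
noncomputable def frameSpan (v : {v : Fin p → ZMod m ⊗[ℤ] Λ // IsFrame (J.baseChange (ZMod m)) v}) :
    ModIsotropic J m p :=
  ⟨Submodule.span (ZMod m) (Set.range v.1), fun _ hx _ hy => v.2.span_isotropic hx hy,
    ⟨Module.Basis.span v.2.linearIndependent⟩, v.2.exists_isCompl⟩

theorem frameSpan_surjective (hu : Function.Bijective J) (hJ : J.IsAlt) :
    Function.Surjective (frameSpan (J := J) (m := m) (p := p)) := by
  rintro ⟨W, hW, ⟨b⟩, W', hc⟩
  have h := isReduction_reduce J m
  refine ⟨⟨fun i => (b i : ZMod m ⊗[ℤ] Λ), fun i j => hW _ (b i).2 _ (b j).2, fun c => ?_⟩,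
    Subtype.ext ?_⟩
  -- The complement `W'` extends the functional `b i ↦ c i` to the whole module; freeness of `Λ`
  -- lifts it to an integral functional, which unimodularity represents by a vector.
  · let L : ZMod m ⊗[ℤ] Λ →ₗ[ZMod m] ZMod m :=
      (b.constr (ZMod m) c) ∘ₗ Submodule.projectionOnto W W' hc
    obtain ⟨l, hl⟩ := Module.projective_lifting_property
      (Int.castAddHom (ZMod m)).toIntLinearMap
      (L.toAddMonoidHom.comp (reduce Λ m)).toIntLinearMap ZMod.intCast_surjective
    obtain ⟨z, hz⟩ := hu.2 (-l)
    refine ⟨reduce Λ m z, fun i => ?_⟩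
    obtain ⟨x, hx⟩ := h.surjective (b i)
    rw [← hx, h.map_form, ← hJ.neg_eq, hz, LinearMap.neg_apply, neg_neg]
    refine (LinearMap.congr_fun hl x).trans ?_
    change L (reduce Λ m x) = c i
    rw [hx]
    simp [L]
  · change Submodule.span (ZMod m) (Set.range fun i => (b i : ZMod m ⊗[ℤ] Λ)) = W
    have := congrArg (Submodule.map W.subtype) b.span_eq
    rw [Submodule.map_span, Submodule.map_top, Submodule.range_subtype, ← Set.range_comp] at this
    exact this

theorem card_frame_eq_card_modIsotropic (hu : Function.Bijective J) (hJ : J.IsAlt) :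
    Nat.card {v : Fin p → ZMod m ⊗[ℤ] Λ // IsFrame (J.baseChange (ZMod m)) v} =
      Nat.card (ModIsotropic J m p) * Nat.card (GL (Fin p) (ZMod m)) := by
  refine card_eq_mul_of_fibers frameSpan (frameSpan_surjective hu hJ)
    (fun A v => ⟨comb A.1 v.1, v.2.comb A⟩)
    (fun v A A' hA => Units.ext (v.2.comb_injective (congrArg Subtype.val hA))) fun v w => ?_
  have := v.2.span_eq_span_iff w.2
  constructor
  · intro h
    obtain ⟨A, hA⟩ := this.1 (congrArg Subtype.val h)
    exact ⟨A, Subtype.ext hA⟩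
  · rintro ⟨A, hA⟩
    exact Subtype.ext (this.2 ⟨A, congrArg Subtype.val hA⟩)

end ModFrames

/-! ### Rational isotropic subspaces -/

section RationalFrames

variable {Λ : Type*} [AddCommGroup Λ] {J : LinearMap.BilinForm ℤ Λ} {p : ℕ}

variable (Λ) in
/-- The inclusion of a lattice in its rational vector space. -/
noncomputable def toRat : Λ →ₗ[ℤ] ℚ ⊗[ℤ] Λ := TensorProduct.mk ℤ ℚ Λ 1

theorem toRat_apply (x : Λ) : toRat Λ x = 1 ⊗ₜ[ℤ] x := rfl

theorem baseChange_toRat (x y : Λ) : J.baseChange ℚ (toRat Λ x) (toRat Λ y) = J x y := by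
  simp [toRat_apply]

theorem toRat_zsmul (a : ℤ) (x : Λ) : toRat Λ (a • x) = (a : ℚ) • toRat Λ x := by
  rw [map_zsmul, Int.cast_smul_eq_zsmul]

theorem toRat_comb (A : Matrix (Fin p) (Fin p) ℤ) (v : Fin p → Λ) :
    (fun i => toRat Λ (comb A v i)) = comb (A.map (Int.castRingHom ℚ)) fun i => toRat Λ (v i) := by
  ext i
  simp only [comb, map_sum, toRat_zsmul]
  rfl

theorem toRat_injective [Module.Free ℤ Λ] : Function.Injective (toRat Λ) := by
  let b := Module.Free.chooseBasis ℤ Λ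
  intro x y h
  refine b.ext_elem fun i => ?_
  have := congrArg (fun t => (b.baseChange ℚ).repr t i) h
  simpa [toRat_apply] using this

theorem exists_smul_eq_toRat (t : ℚ ⊗[ℤ] Λ) : ∃ (d : ℤ) (x : Λ), d ≠ 0 ∧ (d : ℚ) • t = toRat Λ x := by
  induction t using TensorProduct.induction_on with
  | zero => exact ⟨1, 0, one_ne_zero, by simp⟩
  | add s t hs ht =>
    obtain ⟨d, x, hd, hx⟩ := hs
    obtain ⟨e, y, he, hy⟩ := ht
    refine ⟨d * e, e • x + d • y, mul_ne_zero hd he, ?_⟩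
    rw [map_add, toRat_zsmul, toRat_zsmul, ← hx, ← hy, smul_add, smul_smul, smul_smul]
    push_cast
    rw [mul_comm (e : ℚ)]
  | tmul a x =>
    refine ⟨a.den, a.num • x, by exact_mod_cast a.den_ne_zero, ?_⟩
    rw [toRat_zsmul, toRat_apply, TensorProduct.smul_tmul', TensorProduct.smul_tmul']
    congr 1
    simp

theorem IsFrame.toRat {v : Fin p → Λ} (h : IsFrame J v) :
    IsFrame (J.baseChange ℚ) fun i => toRat Λ (v i) := by
  refine ⟨fun i j => by rw [baseChange_toRat, h.isotropic, Int.cast_zero], fun c => ?_⟩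
  choose f hf using fun i => h.split (Pi.single i 1)
  refine ⟨∑ j, c j • SymplecticLattice.toRat Λ (f j), fun i => ?_⟩
  simp [baseChange_toRat, hf, Pi.single_apply]

/-- The rational isotropic subspace spanned by a frame. -/
noncomputable def ratSpan (v : {v : Fin p → Λ // IsFrame J v}) : RatIsotropic J p :=
  ⟨Submodule.span ℚ (Set.range fun i => toRat Λ (v.1 i)),
    fun _ hx _ hy => v.2.toRat.span_isotropic hx hy, by
      rw [finrank_span_eq_card v.2.toRat.linearIndependent, Fintype.card_fin]⟩

/-- The rational coefficients are the pairings of `x` with lattice vectors dual to the frame, hence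
integers. -/
theorem IsFrame.mem_span_of_toRat [Module.Free ℤ Λ] {v : Fin p → Λ} (h : IsFrame J v) {x : Λ}
    (hx : SymplecticLattice.toRat Λ x ∈
      Submodule.span ℚ (Set.range fun i => SymplecticLattice.toRat Λ (v i))) :
    x ∈ Submodule.span ℤ (Set.range v) := by
  obtain ⟨a, ha⟩ := (Submodule.mem_span_range_iff_exists_fun ℚ).1 hx
  choose f hf using fun i => h.split (Pi.single i 1)
  have hcoef : ∀ i, a i = J x (f i) := fun i => by
    rw [← baseChange_toRat, ← ha]
    simp [LinearMap.sum_apply, baseChange_toRat, hf, Pi.single_apply]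
  refine (Submodule.mem_span_range_iff_exists_fun ℤ).2 ⟨fun i => J x (f i), toRat_injective ?_⟩
  rw [← ha, map_sum]
  exact Finset.sum_congr rfl fun i _ => by rw [toRat_zsmul, hcoef]

theorem ratSpan_eq_iff [Module.Free ℤ Λ] (v w : {v : Fin p → Λ // IsFrame J v}) :
    ratSpan v = ratSpan w ↔ ∃ A : GL (Fin p) ℤ, w.1 = comb A.1 v.1 := by
  constructor
  · intro h
    have h' : Submodule.span ℚ (Set.range fun i => toRat Λ (v.1 i)) =
      Submodule.span ℚ (Set.range fun i => toRat Λ (w.1 i)) := congrArg Subtype.val h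
    obtain ⟨A, hA⟩ := v.2.exists_comb_of_mem_span w.2
      (fun i => v.2.mem_span_of_toRat (h' ▸ Submodule.subset_span ⟨i, rfl⟩))
      (fun i => w.2.mem_span_of_toRat (h' ▸ Submodule.subset_span ⟨i, rfl⟩))
    exact ⟨A, hA.symm⟩
  · rintro ⟨A, hA⟩
    apply Subtype.ext
    change Submodule.span ℚ (Set.range fun i => toRat Λ (v.1 i)) =
      Submodule.span ℚ (Set.range fun i => toRat Λ (w.1 i))
    rw [hA, toRat_comb]
    exact (span_comb (Matrix.GeneralLinearGroup.map (Int.castRingHom ℚ) A) _).symm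

theorem ratSpan_surjective [Module.Free ℤ Λ] [Module.Finite ℤ Λ] (hu : Function.Bijective J)
    (hJ : J.IsAlt) : Function.Surjective (ratSpan (J := J) (p := p)) := by
  rintro ⟨W, hW, hp⟩
  -- `N` is W ∩ Λ. It is saturated, so `Λ ⧸ N` is torsion-free, hence free, and `N` is a direct
  -- summand; projecting to it extends functionals on `N` to `Λ`, which makes a basis of `N` a
  -- frame.
  let N : Submodule ℤ Λ := (W.restrictScalars ℤ).comap (toRat Λ)
  have hN : ∀ x, x ∈ N ↔ toRat Λ x ∈ W := fun x => Iff.rfl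
  have hsat : ∀ (a : ℤ) (x : Λ), a ≠ 0 → a • x ∈ N → x ∈ N := fun a x ha hx => by
    rw [hN, toRat_zsmul] at hx
    exact (W.smul_mem_iff (Int.cast_ne_zero.2 ha)).1 hx
  have htf : Module.IsTorsionFree ℤ (Λ ⧸ N) := by
    refine .of_smul_eq_zero fun a x hax => ?_
    obtain ⟨x, rfl⟩ := N.mkQ_surjective x
    rw [← map_smul, Submodule.mkQ_apply, Submodule.Quotient.mk_eq_zero] at hax
    rw [Submodule.mkQ_apply, Submodule.Quotient.mk_eq_zero]
    exact or_iff_not_imp_left.2 fun ha => hsat a x ha hax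
  obtain ⟨s, hs⟩ := Module.projective_lifting_property N.mkQ LinearMap.id N.mkQ_surjective
  let b := Module.finBasis ℤ N
  have hretract : ∀ x : Λ, x - s (N.mkQ x) ∈ N := fun x => by
    rw [← Submodule.Quotient.mk_eq_zero, ← Submodule.mkQ_apply, map_sub, sub_eq_zero]
    exact (LinearMap.congr_fun hs (N.mkQ x)).symm
  let π : Λ →ₗ[ℤ] N := LinearMap.codRestrict N (LinearMap.id - s ∘ₗ N.mkQ) hretract
  have hπ : ∀ x : N, π x = x := fun x => by
    have : N.mkQ (x : Λ) = 0 := (Submodule.Quotient.mk_eq_zero N).2 x.2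
    apply Subtype.ext
    change (x : Λ) - s (N.mkQ x) = x
    rw [this, map_zero, sub_zero]
  have hframe : IsFrame J fun i => (b i : Λ) := by
    refine ⟨fun i j => ?_, fun c => ?_⟩
    · have := hW _ (b i).2 _ (b j).2
      rw [baseChange_toRat] at this
      exact_mod_cast this
    · obtain ⟨z, hz⟩ := hu.2 (-(b.constr ℤ c ∘ₗ π))
      refine ⟨z, fun i => ?_⟩
      rw [← hJ.neg_eq, hz, LinearMap.neg_apply, neg_neg, LinearMap.comp_apply, hπ, b.constr_basis]
  have hspan : Submodule.span ℚ (Set.range fun i => toRat Λ (b i)) = W := by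
    apply le_antisymm
    · rw [Submodule.span_le]
      rintro _ ⟨i, rfl⟩
      exact (b i).2
    · intro w hw
      obtain ⟨d, x, hd, hx⟩ := exists_smul_eq_toRat w
      have hxN : x ∈ N := by
        rw [hN, ← hx]
        exact W.smul_mem _ hw
      have hd' : (d : ℚ) ≠ 0 := Int.cast_ne_zero.2 hd
      rw [← (Submodule.span ℚ _).smul_mem_iff hd', hx]
      have hsum : x = ∑ i, b.repr ⟨x, hxN⟩ i • (b i : Λ) := by
        have := congrArg Subtype.val (b.sum_repr ⟨x, hxN⟩)
        rw [Submodule.coe_sum] at this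
        exact this.symm
      rw [hsum, map_sum]
      refine Submodule.sum_mem _ fun i _ => ?_
      rw [toRat_zsmul]
      exact Submodule.smul_mem _ _ (Submodule.subset_span ⟨i, rfl⟩)
  have hr : Module.finrank ℤ N = p := by
    rw [← hp, ← hspan, finrank_span_eq_card hframe.toRat.linearIndependent, Fintype.card_fin]
  clear_value b
  subst hr
  exact ⟨⟨_, hframe⟩, Subtype.ext hspan⟩

end RationalFrames

/-! ### Orbits of the level subgroup and the final count -/

section Orbits

variable {Λ : Type*} [AddCommGroup Λ] {J : LinearMap.BilinForm ℤ Λ} {m p : ℕ}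

theorem sp_isFrame (γ : sp J) {v : Fin p → Λ} (h : IsFrame J v) :
    IsFrame J fun i => γ.1 (v i) := by
  refine ⟨fun i j => by rw [γ.2, h.isotropic], fun c => ?_⟩
  obtain ⟨y, hy⟩ := h.split c
  exact ⟨γ.1 y, fun i => by rw [γ.2, hy]⟩

theorem smul_ratSpan (γ : sp J) (v : {v : Fin p → Λ // IsFrame J v}) :
    γ • ratSpan v = ratSpan ⟨fun i => γ.1 (v.1 i), sp_isFrame γ v.2⟩ := by
  apply Subtype.ext
  change (Submodule.span ℚ _).map (spBaseChange ℚ J γ) = Submodule.span ℚ _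
  rw [Submodule.map_span, ← Set.range_comp]
  rfl

theorem mem_spLevel {γ : sp J} : γ ∈ spLevel J m ↔ ∀ x, reduce Λ m (γ.1 x) = reduce Λ m x := by
  constructor
  · intro h x
    exact LinearMap.congr_fun (MonoidHom.mem_ker.1 h) (1 ⊗ₜ[ℤ] x)
  · intro h
    refine MonoidHom.mem_ker.2 (LinearMap.ext fun t => ?_)
    induction t using TensorProduct.induction_on with
    | zero => simp
    | add s t hs ht => rw [map_add, map_add, hs, ht]
    | tmul a x =>
      rw [spBaseChange_tmul, Module.End.one_apply, ← mul_one a, ← smul_eq_mul,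
        ← TensorProduct.smul_tmul', ← TensorProduct.smul_tmul']
      exact congrArg _ (h x)

theorem reduce_comb (P : GL (Fin p) ℤ) (v : Fin p → Λ) :
    (fun i => reduce Λ m (comb P.1 v i)) =
      comb (Matrix.GeneralLinearGroup.map (Int.castRingHom (ZMod m)) P).1
        fun i => reduce Λ m (v i) := by
  ext i
  simp only [comb, map_sum, map_zsmul, map_apply_GL, Int.cast_smul_eq_zsmul]

variable [Module.Free ℤ Λ] [Module.Finite ℤ Λ]

/-- The level `m` subgroup acts transitively on the frames with a given reduction. -/
theorem exists_spLevel_of_reduce_eq (hu : Function.Bijective J) (hJ : J.IsAlt) {v w : Fin p → Λ}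
    (hv : IsFrame J v) (hw : IsFrame J w) (h : ∀ i, reduce Λ m (v i) = reduce Λ m (w i)) :
    ∃ γ : spLevel J m, ∀ i, γ.1.1 (v i) = w i := by
  obtain ⟨α, hα, hαm, hαv⟩ := (isReduction_reduce J m).exists_isometry _ (isReduction_reduce J m)
    hu hu hJ hJ rfl rfl hv hw h
  exact ⟨⟨⟨α, hα⟩, mem_spLevel.2 hαm⟩, hαv⟩

/-- Two frames span rational subspaces in the same orbit of the level `m` subgroup if and only if
their reductions differ by a matrix of determinant `±1`. -/
theorem orbit_ratSpan_iff (hu : Function.Bijective J) (hJ : J.IsAlt)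
    (v w : {v : Fin p → Λ // IsFrame J v}) :
    (Quotient.mk _ (ratSpan v) : MulAction.orbitRel.Quotient (spLevel J m) (RatIsotropic J p)) =
      Quotient.mk _ (ratSpan w) ↔
    ∃ A : detPlusMinusOne p m,
      (fun i => reduce Λ m (w.1 i)) = comb A.1.1 fun i => reduce Λ m (v.1 i) := by
  rw [eq_comm, Quotient.eq, MulAction.orbitRel_apply, MulAction.mem_orbit_iff]
  constructor
  · rintro ⟨γ, hγ⟩
    change γ.1 • ratSpan v = ratSpan w at hγ
    rw [smul_ratSpan, ratSpan_eq_iff] at hγ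
    obtain ⟨P, hP⟩ := hγ
    refine ⟨⟨_, mem_detPlusMinusOne_iff_exists.2 ⟨P, rfl⟩⟩, ?_⟩
    rw [hP, reduce_comb]
    simp only [mem_spLevel.1 γ.2]
  · rintro ⟨A, hA⟩
    -- Changing `v` by an integral lift `P` of `A` keeps its rational span and gives it the
    -- reduction of `w`.
    obtain ⟨P, hP⟩ := mem_detPlusMinusOne_iff_exists.1 A.2
    rw [← hP, ← reduce_comb] at hA
    obtain ⟨γ, hγ⟩ := exists_spLevel_of_reduce_eq hu hJ (v.2.comb P) w.2
      fun i => (congrFun hA i).symm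
    refine ⟨γ, ?_⟩
    have h1 : ratSpan v = ratSpan ⟨_, v.2.comb P⟩ := (ratSpan_eq_iff _ _).2 ⟨P, rfl⟩
    change γ.1 • ratSpan v = ratSpan w
    rw [h1, smul_ratSpan]
    exact congrArg ratSpan (Subtype.ext (funext hγ))

/-- The map from frames modulo `m` to orbits of rational subspaces. -/
theorem exists_frame_to_orbit (hu : Function.Bijective J) (hJ : J.IsAlt)
    (hp : 2 * p ≤ Module.finrank ℤ Λ) :
    ∃ Φ : {v : Fin p → ZMod m ⊗[ℤ] Λ // IsFrame (J.baseChange (ZMod m)) v} →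
        MulAction.orbitRel.Quotient (spLevel J m) (RatIsotropic J p),
      Function.Surjective Φ ∧
      ∀ v w, Φ v = Φ w ↔ ∃ A : detPlusMinusOne p m, w.1 = comb A.1.1 v.1 := by
  have h := isReduction_reduce J m
  choose l hl hlv using
    fun v : {v : Fin p → ZMod m ⊗[ℤ] Λ // IsFrame (J.baseChange (ZMod m)) v} =>
      h.exists_lift_frame p hu hJ hp v.2
  refine ⟨fun v => Quotient.mk _ (ratSpan ⟨l v, hl v⟩), fun q => ?_, fun v w => ?_⟩
  · obtain ⟨W, rfl⟩ := Quotient.mk_surjective q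
    obtain ⟨v, rfl⟩ := ratSpan_surjective hu hJ W
    refine ⟨⟨_, h.isFrame v.2⟩, (orbit_ratSpan_iff hu hJ _ _).2 ⟨1, ?_⟩⟩
    rw [OneMemClass.coe_one, Units.val_one, comb_one]
    exact funext fun i => (hlv ⟨_, h.isFrame v.2⟩ i).symm
  · rw [orbit_ratSpan_iff hu hJ]
    simp only [hlv]

/-- The second count of frames: `detPlusMinusOne p m` acts simply transitively on the fibres over
the orbits. -/
theorem card_frame_eq_orbitCount (hu : Function.Bijective J) (hJ : J.IsAlt)
    (hp : 2 * p ≤ Module.finrank ℤ Λ) :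
    Nat.card {v : Fin p → ZMod m ⊗[ℤ] Λ // IsFrame (J.baseChange (ZMod m)) v} =
      orbitCount J m p * Nat.card (detPlusMinusOne p m) := by
  obtain ⟨Φ, hΦ, hΦ'⟩ := exists_frame_to_orbit (m := m) hu hJ hp
  refine card_eq_mul_of_fibers Φ hΦ (fun A v => ⟨comb A.1.1 v.1, v.2.comb A.1⟩)
    (fun v A A' hA => Subtype.ext (Units.ext (v.2.comb_injective (congrArg Subtype.val hA))))
    fun v w => ?_
  rw [hΦ']
  simp only [Subtype.ext_iff]

theorem orbitCount_eq (hm : 1 ≤ m) (hu : Function.Bijective J) (hJ : J.IsAlt) (hp1 : 1 ≤ p)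
    (hp : 2 * p ≤ Module.finrank ℤ Λ) :
    (orbitCount J m p : ℚ) = epsilon m * m.totient * Nat.card (ModIsotropic J m p) := by
  have : NeZero m := ⟨by omega⟩
  have h := (card_frame_eq_orbitCount (m := m) hu hJ hp).symm.trans
    (card_frame_eq_card_modIsotropic hu hJ)
  have h' := congrArg (Nat.cast : ℕ → ℚ) h
  rw [Nat.cast_mul, Nat.cast_mul, card_GL_eq hp1 hm] at h'
  have hpos : (Nat.card (detPlusMinusOne p m) : ℚ) ≠ 0 := Nat.cast_ne_zero.2 Nat.card_pos.ne'
  apply mul_right_cancel₀ hpos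
  rw [h']
  ring

theorem card_modIsotropic_maximal {g : ℕ} (hm : 1 ≤ m) (hu : Function.Bijective J) (hJ : J.IsAlt)
    (hg : Module.finrank ℤ Λ = 2 * g) :
    (Nat.card (ModIsotropic J m g) : ℚ) = (m : ℚ) ^ (g * (g + 1) / 2) *
      ∏ q ∈ m.primeFactors, ∏ i ∈ Finset.Icc 1 g, (1 + 1 / (q : ℚ) ^ i) := by
  have : NeZero m := ⟨by omega⟩
  have h := (isReduction_reduce J m).card_frame_maximal g hu hJ hg
  rw [card_frame_eq_card_modIsotropic hu hJ, Nat.cast_mul] at h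
  exact mul_right_cancel₀ (Nat.cast_ne_zero.2 Nat.card_pos.ne') h

end Orbits

end SymplecticLattice

theorem mainTheorem12 {Λ : Type*} [AddCommGroup Λ] [Module.Free ℤ Λ] [Module.Finite ℤ Λ]
    (g m : ℕ) (hg : 1 ≤ g) (hm : 1 ≤ m) (hrank : Module.finrank ℤ Λ = 2 * g)
    (J : LinearMap.BilinForm ℤ Λ) (halt : J.IsAlt) (hunimodular : Function.Bijective J) :
    (∀ p : ℕ, 1 ≤ p → p ≤ g →
      Finite (MulAction.orbitRel.Quotient (SymplecticLattice.spLevel J m)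
        (SymplecticLattice.RatIsotropic J p)) ∧
      (SymplecticLattice.orbitCount J m p : ℚ) =
        SymplecticLattice.epsilon m * (Nat.totient m : ℚ) *
          (Nat.card (SymplecticLattice.ModIsotropic J m p) : ℚ)) ∧
    (Nat.card (SymplecticLattice.ModIsotropic J m g) : ℚ) =
      (m : ℚ) ^ (g * (g + 1) / 2) *
        ∏ q ∈ m.primeFactors, ∏ i ∈ Finset.Icc 1 g, (1 + 1 / (q : ℚ) ^ i) ∧
    (SymplecticLattice.orbitCount J m g : ℚ) =
      SymplecticLattice.epsilon m * (m : ℚ) ^ (g * (g + 1) / 2) * (Nat.totient m : ℚ) *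
        ∏ q ∈ m.primeFactors, ∏ i ∈ Finset.Icc 1 g, (1 + 1 / (q : ℚ) ^ i) := by
  have : NeZero m := ⟨by omega⟩
  have hcard := SymplecticLattice.card_modIsotropic_maximal hm hunimodular halt hrank
  refine ⟨fun p hp1 hp => ⟨?_, SymplecticLattice.orbitCount_eq hm hunimodular halt hp1
    (by omega)⟩, hcard, ?_⟩
  -- The orbits are the image of the finite set of frames modulo m. Finiteness needs its own proof,
  -- since `Nat.card` of an infinite type is 0.
  · have := (SymplecticLattice.isReduction_reduce J m).finite
    obtain ⟨Φ, hΦ, -⟩ := SymplecticLattice.exists_frame_to_orbit (m := m) (p := p) hunimodular halt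
      (by omega)
    exact Finite.of_surjective Φ hΦ
  · rw [SymplecticLattice.orbitCount_eq hm hunimodular halt hg (by omega), hcard]
    ring
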